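/- **Lemma 3.5 (negative binomial clusters with reporting delay).** Let $0<T_1<T_2<\cdots$ be the points of a (non-homogeneous) Poisson process on $(0,\infty)$ with locally finite, atomless mean measure $\Lambda$ (only finitely many points if $\Lambda$ has finite total mass), let $(D_k)$ be i.i.d. nonnegative reporting delays with distribution $F_D$, and let $(L_k)$ be i.i.d. additive negative binomial processes: for $p\in(0,1)$, $q=1-p$, and a continuous nondecreasing function $\mu$ on $[0,\infty)$ with $\mu(0)=0$ and $\mu(t)>0$ for $t>0$, each $L_k$ has càdlàg paths, $L_k(t)=0$ for $t\le 0$, independent increments, and for $0\le a\le b$ the increment $L_k(b)-L_k(a)$ is $NB(\mu(b)-\mu(a),p)$ distributed, where $NB(r,p)$ has mass $\binom{r+k-1}{k}p^{r}q^{k}$ at $k=0,1,2,\ldots$. Assume that $(T_k)$ and $(L_k)$ are independent, and that $(D_k)$ is independent of the pair $((T_k),(L_k))$. Put $$M(t)=\sum_{k\ge1} 1_{\{T_k\le 1\}}L_k\big(t-(T_k+D_k)\big),\quad M(t,t+s]=M(t+s)-M(t),\quad \widehat N(t)=\#\{k: T_k\le 1,\ T_k+D_k\le t\}.$$ Write $\mu(a,b]=\mu(b)-\mu(a)$,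 $\mu^2(a,b]=(\mu(b)-\mu(a))^2$, and let $\Lambda*F_D$ be the convolution of $F_D$ with the restriction of $\Lambda$ to $[0,1]$. Let $t\ge1$, $s>0$ and $\ell\in\{0,1,2,\ldots\}$ with $P(\widehat N(t)=\ell)>0$. Then, given $\{\widehat N(t)=\ell\}$, the increment $M(t,t+s]$ has finite second moment, its conditional expectation is $$\widetilde M_\ell(t,t+s]=\ell\,\frac qp\int_0^t\mu(t-u,t+s-u]\,\frac{\Lambda*F_D(du)}{E[\widehat N(t)]}+\frac qp\int_0^1\int_{r=t-v}^{t+s-v}\mu(t+s-v-r)\,\Lambda(dv)F_D(dr),$$ and its conditional variance is $$\begin{aligned}\mathrm{Var}(M(t,t+s]\mid\widehat N(t)=\ell)&=\frac{\widetilde M_\ell(t,t+s]}{p}+\ell\,\frac{q^2}{p^2}\int_0^t\mu^2(t-u,t+s-u]\,\frac{\Lambda*F_D(du)}{E[\widehat N(t)]}\\&\quad-\ell\,\frac{q^2}{p^2}\left(\int_0^t\mu(t-u,t+s-u]\,\frac{\Lambda*F_D(du)}{E[\widehat N(t)]}\right)^2\\&\quad+\frac{q^2}{p^2}\int_0^1\int_{r=t-v}^{t+s-v}\mu^2(t+s-v-r)\,\Lambda(dv)F_D(dr).\end{aligned}$$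 (If $E[\widehat N(t)]=0$, then necessarily $\ell=0$, and the terms with factor $\ell$ are read as $0$.) -/

import Mathlib

open MeasureTheory ProbabilityTheory Set Filter Topology
open scoped NNReal ENNReal

/-- The counting process `N(t) = #{j : T_j ≤ t}` of a sequence of arrival times in `(0, ∞]`
(the value `∞` means that the corresponding arrival never occurs). -/
noncomputable def arrivalCount {Ω : Type*} (T : ℕ → Ω → ℝ≥0∞) (t : ℝ≥0) (ω : Ω) : ℕ :=
  {j : ℕ | T j ω ≤ (t : ℝ≥0∞)}.ncard

/-- `0 < T_0 < T_1 < ⋯` are the points of a (possibly non-homogeneous) Poisson process on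
`(0, ∞)` with mean measure `Λ`: the counting process has independent increments, and
`N(b) - N(a)` is Poisson distributed with parameter `Λ((a, b])`.  When `Λ` has finite total mass
there are only finitely many points, and the remaining `T_j` are `∞`. -/
structure IsPoissonArrivals {Ω : Type*} [MeasurableSpace Ω] (T : ℕ → Ω → ℝ≥0∞)
    (Λ : Measure ℝ) (P : Measure Ω) : Prop where
  measurable : ∀ j, Measurable (T j)
  pos : ∀ᵐ ω ∂P, ∀ j, 0 < T j ω
  mono : ∀ᵐ ω ∂P, ∀ j, T j ω ≤ T (j + 1) ω
  strict : ∀ᵐ ω ∂P, ∀ j, T j ω ≠ ⊤ → T j ω < T (j + 1) ω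
  locallyFinite : ∀ᵐ ω ∂P, ∀ b : ℝ≥0, {j : ℕ | T j ω ≤ (b : ℝ≥0∞)}.Finite
  indep : HasIndepIncrements (fun (t : ℝ≥0) ω => (arrivalCount T t ω : ℝ)) P
  law : ∀ a b : ℝ≥0, a ≤ b →
    P.map (fun ω => arrivalCount T b ω - arrivalCount T a ω) =
      poissonMeasure (Λ (Ioc (a : ℝ) b)).toNNReal

/-- The mean value function of a cluster: continuous, nondecreasing, positive on `(0, ∞)`, with
value `0` at `0`; it is extended by `0` to negative times. -/
structure IsMeanValueFunction (μ : ℝ → ℝ) : Prop where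
  monotone : Monotone μ
  continuous : Continuous μ
  eq_zero : ∀ t ≤ 0, μ t = 0
  pos : ∀ t, 0 < t → 0 < μ t

/-- The probability mass function of the negative binomial distribution `NB(r, p)`, `r ≥ 0`:
`k ↦ binom(r + k - 1, k) p ^ r (1 - p) ^ k`, with the generalized binomial coefficient.  For
`r = 0` this is the unit mass at `0`. -/
noncomputable def negBinomialPMF (r p : ℝ) (k : ℕ) : ℝ :=
  Ring.choose (r + k - 1) k * p ^ r * (1 - p) ^ k

/-- `X` is an additive `NB(μ(t), p)` process, extended by `0` to negative times: it starts at `0`,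
has independent increments, càdlàg paths, and `X(b) - X(a)` is `NB(μ(b) - μ(a), p)` distributed
for `a ≤ b`. -/
structure IsNegBinomialProcess {Ω : Type*} [MeasurableSpace Ω] (X : ℝ → Ω → ℝ)
    (μ : ℝ → ℝ) (p : ℝ) (P : Measure Ω) : Prop where
  measurable : ∀ t, Measurable (X t)
  eq_zero : ∀ᵐ ω ∂P, ∀ t ≤ 0, X t ω = 0
  indep : HasIndepIncrements X P
  law : ∀ a b : ℝ, a ≤ b → ∀ k : ℕ,
    P.real {ω | X b ω - X a ω = (k : ℝ)} = negBinomialPMF (μ b - μ a) p k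
  cadlag : ∀ᵐ ω ∂P, ∀ t : ℝ, ContinuousWithinAt (fun r => X r ω) (Ici t) t ∧
    ∃ l : ℝ, Tendsto (fun r => X r ω) (𝓝[<] t) (𝓝 l)

/-- The Poisson cluster model with reporting delays: arrivals `T_k` from a Poisson process with
mean measure `Λ`, iid delays `D_k ≥ 0` with distribution `F_D`, and iid additive
`NB(μ(t), p)` clusters `L_k`; the sequences `(L_k)` and `(T_k)` are independent, and `(D_k)` is
independent of the pair. -/
structure IsDelayedNBClusterModel {Ω : Type*} [MeasurableSpace Ω] (T : ℕ → Ω → ℝ≥0∞)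
    (D : ℕ → Ω → ℝ) (L : ℕ → ℝ → Ω → ℝ) (Λ F_D : Measure ℝ) (μ : ℝ → ℝ) (p : ℝ)
    (P : Measure Ω) : Prop where
  arrivals : IsPoissonArrivals T Λ P
  delay_measurable : ∀ k, Measurable (D k)
  delay_law : ∀ k, P.map (D k) = F_D
  delay_nonneg : ∀ k, ∀ᵐ ω ∂P, 0 ≤ D k ω
  delay_iIndep : iIndepFun D P
  cluster : ∀ k, IsNegBinomialProcess (L k) μ p P
  cluster_iIndep : iIndepFun (fun k ω (t : ℝ) => L k t ω) P
  indep_arrivals_clusters :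
    IndepFun (fun ω (k : ℕ) => T k ω) (fun ω (k : ℕ) (t : ℝ) => L k t ω) P
  indep_delays :
    IndepFun (fun ω (k : ℕ) => D k ω)
      (fun ω => ((fun k : ℕ => T k ω), (fun (k : ℕ) (t : ℝ) => L k t ω))) P

open Classical in
/-- `M(t) = ∑_k 1{T_k ≤ 1} L_k(t - (T_k + D_k))`; almost surely only finitely many terms are
nonzero. -/
noncomputable def delayedTotal {Ω : Type*} (T : ℕ → Ω → ℝ≥0∞) (D : ℕ → Ω → ℝ)
    (L : ℕ → ℝ → Ω → ℝ) (t : ℝ) (ω : Ω) : ℝ :=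
  ∑' k, if T k ω ≤ 1 then L k (t - ((T k ω).toReal + D k ω)) ω else 0

/-- The number of claims reported by time `t`: `#{k : T_k ≤ 1, T_k + D_k ≤ t}`. -/
noncomputable def reportedCount {Ω : Type*} (T : ℕ → Ω → ℝ≥0∞) (D : ℕ → Ω → ℝ)
    (t : ℝ) (ω : Ω) : ℕ :=
  {k : ℕ | T k ω ≤ 1 ∧ (T k ω).toReal + D k ω ≤ t}.ncard

/-- The convolution of `F_D` with the mean measure `Λ` of the arrivals in `[0, 1]`. -/
noncomputable def reportMeasure (Λ F_D : Measure ℝ) : Measure ℝ :=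
  (Λ.restrict (Icc 0 1)).conv F_D

/-- The increment `M(t, t+s] = M(t+s) - M(t)`. -/
noncomputable def delayedIncrement {Ω : Type*} (T : ℕ → Ω → ℝ≥0∞) (D : ℕ → Ω → ℝ)
    (L : ℕ → ℝ → Ω → ℝ) (t s : ℝ) (ω : Ω) : ℝ :=
  delayedTotal T D L (t + s) ω - delayedTotal T D L t ω

/-- The expected number of claims reported by time `t`. -/
noncomputable def meanReported {Ω : Type*} [MeasurableSpace Ω] (T : ℕ → Ω → ℝ≥0∞)
    (D : ℕ → Ω → ℝ) (t : ℝ) (P : Measure Ω) : ℝ :=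
  ∫ ω, (reportedCount T D t ω : ℝ) ∂P

/-- The conditional probability measure given that `ℓ` claims have been reported by time `t`. -/
noncomputable def condReported {Ω : Type*} [MeasurableSpace Ω] (T : ℕ → Ω → ℝ≥0∞)
    (D : ℕ → Ω → ℝ) (t : ℝ) (ℓ : ℕ) (P : Measure Ω) : Measure Ω :=
  ProbabilityTheory.cond P {ω | reportedCount T D t ω = ℓ}

/-! Let `R_k = T_k + D_k`, let `φ_k` be the contribution of cluster `k` to `(t, t+s]`, and let `ρ =
Λ * F_D`. Everything follows from one generating functional over the claims with `T_k ≤ 1`: for `x,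
z ∈ [0, 1]`, `E ∏ z^{1{R_k ≤ t}} (1 + x φ_k) = exp((z - 1) a + x (b₀ + z b₁))`, where `a = ρ(-∞,
t]`, and `b₀`, `b₁` integrate the mean contribution of a cluster started at `w` over `w > t` and `w
≤ t` (`lintegral_prod_clusterIncrement`). The same identity holds for `φ_k ^ 2`, with integrated
second moments `c₀`, `c₁`.

Comparing coefficients of `x^i z^ℓ` gives the expectation of the `i`-th elementary symmetric
function of the `φ_k` on the event that `ℓ` claims are reported (`setLIntegral_esymmSeq`). Since `(∑
φ_k)² = ∑ φ_k² + 2 e₂(φ)`, the cases `i = 0, 1, 2` yield the conditional mean `b₀ + ℓ b₁ / a` and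
variance `c₀ + ℓ c₁ / a - ℓ (b₁ / a)²` (`cond_markedCount_moments`). Neither thinning nor the order
statistics property is invoked.

The functional itself comes from independent increments: on a grid the product over points is a
product over cells, and refining the grid reaches every bounded left-continuous function
(`IsPoissonArrivals.lintegral_prod`). Independence lets clusters and delays be integrated out first
(`lintegral_prod_marks`), and integrating over a delay turns `Λ` into `ρ`. The stated formulas then
follow from the first two moments of the negative binomial law. -/

/-! ### Moments of the negative binomial distribution. -/

theorem succ_mul_multichoose_succ (r : ℝ) (k : ℕ) :
    ((k : ℝ) + 1) * Ring.multichoose r (k + 1) = r * Ring.multichoose (r + 1) k := by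
  have h1 := Ring.factorial_nsmul_multichoose_eq_ascPochhammer r (k + 1)
  have h2 := Ring.factorial_nsmul_multichoose_eq_ascPochhammer (r + 1) k
  rw [Polynomial.ascPochhammer_smeval_eq_eval, nsmul_eq_mul] at h1 h2
  rw [ascPochhammer_succ_left] at h1
  simp only [Polynomial.eval_mul, Polynomial.eval_X, Polynomial.eval_comp, Polynomial.eval_add,
    Polynomial.eval_one] at h1
  rw [← h2, Nat.factorial_succ] at h1
  have hk : (k.factorial : ℝ) ≠ 0 := by positivity
  push_cast at h1
  apply mul_left_cancel₀ hk
  linarith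

theorem negBinomialPMF_eq (r p : ℝ) (k : ℕ) :
    negBinomialPMF r p k = Ring.multichoose r k * p ^ r * (1 - p) ^ k := by
  rw [negBinomialPMF, Ring.multichoose_eq]

/-- Size-biasing a negative binomial law shifts `r` to `r + 1`. Each moment at `r` thus reduces to
lower moments at `r + 1`, and nonnegativity propagates by induction on `k` with `r` varying. -/
theorem negBinomialPMF_succ (r : ℝ) {p : ℝ} (hp0 : 0 < p) (k : ℕ) :
    ((k : ℝ) + 1) * negBinomialPMF r p (k + 1)
      = r * ((1 - p) / p) * negBinomialPMF (r + 1) p k := by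
  rw [negBinomialPMF_eq, negBinomialPMF_eq, Real.rpow_add_one hp0.ne']
  have := succ_mul_multichoose_succ r k
  have hd : (1 - p) / p * p = 1 - p := div_mul_cancel₀ _ hp0.ne'
  linear_combination p ^ r * (1 - p) ^ (k + 1) * this
    - r * Ring.multichoose (r + 1) k * p ^ r * (1 - p) ^ k * hd

/-- This is the binomial series of `(1 - y)^(-r)` at `y = 1 - p`. -/
theorem hasSum_negBinomialPMF (r : ℝ) {p : ℝ} (hp0 : 0 < p) (hp1 : p < 1) :
    HasSum (negBinomialPMF r p) 1 := by
  have h := (Real.one_div_one_sub_rpow_hasFPowerSeriesOnBall_zero r).hasSum (y := 1 - p)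
    (by simp [enorm_eq_nnnorm, ← NNReal.coe_lt_coe, abs_of_pos (sub_pos.2 hp1), hp0])
  have h2 := h.mul_left (p ^ r)
  have hpr : p ^ r ≠ 0 := (Real.rpow_pos_of_pos hp0 r).ne'
  have e : p ^ r * (1 / (1 - (0 + (1 - p))) ^ r) = 1 := by
    rw [zero_add, sub_sub_cancel]; field_simp
  rw [e] at h2
  refine (funext fun k => ?_ : negBinomialPMF r p = _) ▸ h2
  rw [FormalMultilinearSeries.ofScalars_apply_eq, negBinomialPMF, smul_eq_mul]
  ring

theorem hasSum_mul_negBinomialPMF (r : ℝ) {p : ℝ} (hp0 : 0 < p) (hp1 : p < 1) :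
    HasSum (fun k : ℕ => (k : ℝ) * negBinomialPMF r p k) (r * ((1 - p) / p)) := by
  have h := (hasSum_negBinomialPMF (r + 1) hp0 hp1).mul_left (r * ((1 - p) / p))
  rw [← hasSum_nat_add_iff' 1]
  simpa [negBinomialPMF_succ r hp0] using h

theorem hasSum_sq_mul_negBinomialPMF (r : ℝ) {p : ℝ} (hp0 : 0 < p) (hp1 : p < 1) :
    HasSum (fun k : ℕ => (k : ℝ) ^ 2 * negBinomialPMF r p k)
      (r * ((1 - p) / p ^ 2) + r ^ 2 * ((1 - p) ^ 2 / p ^ 2)) := by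
  have h := ((hasSum_mul_negBinomialPMF (r + 1) hp0 hp1).add
    (hasSum_negBinomialPMF (r + 1) hp0 hp1)).mul_left (r * ((1 - p) / p))
  rw [← hasSum_nat_add_iff' 1]
  have e : r * ((1 - p) / p ^ 2) + r ^ 2 * ((1 - p) ^ 2 / p ^ 2)
      - ∑ i ∈ Finset.range 1, (i : ℝ) ^ 2 * negBinomialPMF r p i
      = r * ((1 - p) / p) * ((r + 1) * ((1 - p) / p) + 1) := by
    simp
    field_simp
    ring
  rw [e]
  refine (funext fun k => ?_ : (fun k : ℕ => ((k + 1 : ℕ) : ℝ) ^ 2 * negBinomialPMF r p (k + 1)) = _) ▸ h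
  have := negBinomialPMF_succ r hp0 k
  push_cast
  linear_combination ((k : ℝ) + 1) * this

theorem negBinomialPMF_nonneg {r p : ℝ} (hr : 0 ≤ r) (hp0 : 0 < p) (hp1 : p < 1) (k : ℕ) :
    0 ≤ negBinomialPMF r p k := by
  induction k generalizing r with
  | zero => rw [negBinomialPMF_eq]; simp; positivity
  | succ k ih =>
    have := negBinomialPMF_succ r hp0 k
    have h1 : 0 < 1 - p := by linarith
    have h2 : 0 ≤ r * ((1 - p) / p) * negBinomialPMF (r + 1) p k :=
      mul_nonneg (by positivity) (ih (by positivity))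
    rw [← this] at h2
    exact nonneg_of_mul_nonneg_right h2 (by positivity)

/-! ### Comparison of power series coefficients. -/

/-- A power series with real coefficients that vanishes on `[0, 1]` is zero. -/
theorem coeff_eq_zero_of_hasSum_zero {e : ℕ → ℝ}
    (h : ∀ x ∈ Icc (0 : ℝ) 1, HasSum (fun j => e j * x ^ j) 0) (j : ℕ) : e j = 0 := by
  set q := FormalMultilinearSeries.ofScalars ℝ e with hq
  -- Convergence at `x = 1` makes the coefficients tend to `0`, so the radius is at least `1`.
  have hr : 1 ≤ q.radius := by
    apply q.le_radius_of_tendsto (r := 1) (l := 0)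
    have := (h 1 (by simp)).summable.tendsto_atTop_zero
    simpa [hq] using this.norm
  have hf := q.hasFPowerSeriesOnBall (lt_of_lt_of_le one_pos hr)
  have han : AnalyticAt ℝ q.sum 0 := hf.analyticAt
  have hz : ∀ x ∈ Icc (0 : ℝ) 1, q.sum x = 0 := fun x hx => by
    rw [FormalMultilinearSeries.sum, ← (h x hx).tsum_eq]
    simp [hq, mul_comm]
  -- Zeros accumulate at `0` from the right, which is enough for the identity theorem.
  have hfr : ∃ᶠ x in 𝓝[≠] (0 : ℝ), q.sum x = 0 := by
    have h1 : ∃ᶠ x in 𝓝[>] (0 : ℝ), q.sum x = 0 := by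
      apply Eventually.frequently
      filter_upwards [Ioc_mem_nhdsGT (one_pos : (0 : ℝ) < 1)] with x hx
      exact hz x ⟨hx.1.le, hx.2⟩
    exact h1.filter_mono (nhdsWithin_mono _ fun x hx => ne_of_gt hx)
  have hq0 := hf.hasFPowerSeriesAt.locally_zero_iff.1
    (han.frequently_zero_iff_eventually_zero.1 hfr)
  exact congrFun ((FormalMultilinearSeries.ofScalars_series_eq_zero (E := ℝ)).1 hq0) j

/-- Identification of the coefficients of a power series in `ℝ≥0∞` that is known on `[0, 1]`. -/
theorem ENNReal.coeff_eq_of_tsum_eq {c : ℕ → ℝ≥0∞} {d : ℕ → ℝ} {f : ℝ → ℝ}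
    (h : ∀ x ∈ Icc (0 : ℝ) 1, ∑' j, c j * ENNReal.ofReal x ^ j = ENNReal.ofReal (f x))
    (hf : ∀ x ∈ Icc (0 : ℝ) 1, HasSum (fun j => d j * x ^ j) (f x))
    (hf0 : ∀ x ∈ Icc (0 : ℝ) 1, 0 ≤ f x) (j : ℕ) :
    c j = ENNReal.ofReal (d j) := by
  -- At `x = 1` the coefficients sum to a finite value, so each one is finite.
  have hc : ∀ j, c j ≠ ∞ := by
    apply ENNReal.ne_top_of_tsum_ne_top
    have := h 1 (by simp)
    simp only [ENNReal.ofReal_one, one_pow, mul_one] at this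
    simp [this]
  have hz := coeff_eq_zero_of_hasSum_zero (e := fun j => (c j).toReal - d j) (fun x hx => ?_) j
  · rw [← sub_eq_zero.1 hz, ENNReal.ofReal_toReal (hc j)]
  · have h1 : HasSum (fun j => (c j * ENNReal.ofReal x ^ j).toReal) (f x) := by
      have := ENNReal.hasSum_toReal (f := fun j => c j * ENNReal.ofReal x ^ j) (by simp [h x hx])
      rwa [← ENNReal.tsum_toReal_eq, h x hx, ENNReal.toReal_ofReal (hf0 x hx)] at this
      exact fun j => ENNReal.mul_ne_top (hc j) (by simp)
    have := h1.sub (hf x hx)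
    simpa [ENNReal.toReal_mul, ENNReal.toReal_ofReal hx.1, sub_mul] using this

/-! ### Counting functions and random indices. -/

theorem Nat.eq_Iio_ncard_of_isLowerSet {S : Set ℕ} (hl : IsLowerSet S) (hf : S.Finite) :
    S = Iio S.ncard := by
  classical
  obtain ⟨n, hn⟩ := hf.exists_notMem
  have hex : ∃ n, n ∉ S := ⟨n, hn⟩
  have hS : S = Iio (Nat.find hex) := by
    ext j
    refine ⟨fun hj => ?_, fun hj => by simpa using Nat.find_min hex hj⟩
    by_contra hlt
    exact Nat.find_spec hex (hl (not_lt.1 hlt) hj)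
  have hc : S.ncard = Nat.find hex := by
    conv_lhs => rw [hS, ← Finset.coe_Iio, Set.ncard_coe_finset, Nat.card_Iio]
  rw [hc]; exact hS

/-- A positive `ncard` means that the set is one of countably many finite sets. The value `0` also
covers infinite sets, so its level set is obtained as the complement of the positive ones. -/
theorem measurable_ncard_setOf {α : Type*} [MeasurableSpace α] {q : ℕ → α → Prop}
    (hq : ∀ k, MeasurableSet {ω | q k ω}) : Measurable fun ω => {k | q k ω}.ncard := by
  have hF : ∀ F : Finset ℕ, MeasurableSet {ω | {k | q k ω} = (F : Set ℕ)} := by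
    intro F
    have : {ω | {k | q k ω} = (F : Set ℕ)} = ⋂ k, {ω | q k ω ↔ k ∈ F} := by
      ext ω; simp [Set.ext_iff]
    rw [this]
    refine MeasurableSet.iInter fun k => ?_
    by_cases hk : k ∈ F
    · simpa [hk] using hq k
    · simp only [hk, iff_false]
      exact (hq k).compl
  have hpos : ∀ n : ℕ, MeasurableSet ((fun ω => {k | q k ω}.ncard) ⁻¹' {n + 1}) := by
    intro n
    have : (fun ω => {k | q k ω}.ncard) ⁻¹' {n + 1}
        = ⋃ F ∈ {F : Finset ℕ | F.card = n + 1}, {ω | {k | q k ω} = (F : Set ℕ)} := by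
      ext ω
      simp only [mem_preimage, mem_singleton_iff, mem_iUnion, mem_ofPred_eq, exists_prop]
      constructor
      · intro h
        have hfin := Set.finite_of_ncard_ne_zero (s := {k | q k ω}) (by omega)
        refine ⟨hfin.toFinset, ?_, by simp⟩
        rw [← Set.ncard_eq_toFinset_card _ hfin, h]
      · rintro ⟨F, hF, h⟩
        rw [h, Set.ncard_coe_finset, hF]
    rw [this]
    exact MeasurableSet.biUnion (Set.to_countable _) fun F _ => hF F
  refine measurable_to_countable' fun n => ?_
  cases n with
  | succ n => exact hpos n
  | zero =>
    have : (fun ω => {k | q k ω}.ncard) ⁻¹' {0}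
        = (⋃ n : ℕ, (fun ω => {k | q k ω}.ncard) ⁻¹' {n + 1})ᶜ := by
      ext ω
      simp only [mem_preimage, mem_singleton_iff, mem_compl_iff, mem_iUnion, not_exists]
      constructor
      · intro h n; omega
      · intro h
        by_contra h0
        exact h _ (Nat.succ_pred_eq_of_pos (Nat.pos_of_ne_zero h0)).symm
    rw [this]
    exact (MeasurableSet.iUnion hpos).compl

theorem Measurable.apply_nat {α β : Type*} [MeasurableSpace α] [MeasurableSpace β]
    {f : ℕ → α → β} {N : α → ℕ} (hf : ∀ n, Measurable (f n)) (hN : Measurable N) :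
    Measurable fun ω => f (N ω) ω :=
  (measurable_from_prod_countable_right (f := fun z : ℕ × α => f z.1 z.2) hf).comp
    (hN.prodMk measurable_id)

/-! ### Poisson increments and their generating functions. -/

theorem lintegral_pow_poissonMeasure (r : ℝ≥0) {c : ℝ} (hc : 0 ≤ c) :
    ∫⁻ n, ENNReal.ofReal c ^ n ∂(poissonMeasure r) = ENNReal.ofReal (Real.exp (r * (c - 1))) := by
  have h : HasSum (fun n : ℕ => Real.exp (-r) * r ^ n / n.factorial * c ^ n)
      (Real.exp (r * (c - 1))) := by
    have := (NormedSpace.expSeries_div_hasSum_exp (𝔸 := ℝ) (r * c)).mul_left (Real.exp (-r))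
    rw [← Real.exp_eq_exp_ℝ, ← Real.exp_add] at this
    rw [show (r : ℝ) * (c - 1) = -r + r * c by ring]
    refine (funext fun n => ?_ : (fun n : ℕ => _) = _) ▸ this
    rw [mul_pow]; ring
  rw [poissonMeasure, lintegral_sum_measure, ← h.tsum_eq,
    ENNReal.ofReal_tsum_of_nonneg (fun n => by positivity) h.summable]
  congr with n
  rw [lintegral_smul_measure, lintegral_dirac, ENNReal.ofReal_mul (by positivity),
    ENNReal.ofReal_pow hc, smul_eq_mul]

namespace IsPoissonArrivals

variable {Ω : Type*} [MeasurableSpace Ω] {T : ℕ → Ω → ℝ≥0∞} {Λ : Measure ℝ} {P : Measure Ω}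

theorem measurable_arrivalCount (h : IsPoissonArrivals T Λ P) (t : ℝ≥0) :
    Measurable (arrivalCount T t) :=
  measurable_ncard_setOf fun k => measurableSet_le (h.measurable k) measurable_const

/-- Arrival times are ordered, so the indices of the arrivals up to `b` form a finite initial
segment of `ℕ`. A single null set serves all `b`. -/
theorem le_iff_lt_arrivalCount (h : IsPoissonArrivals T Λ P) :
    ∀ᵐ ω ∂P, ∀ (b : ℝ≥0) (j : ℕ), T j ω ≤ b ↔ j < arrivalCount T b ω := by
  filter_upwards [h.mono, h.locallyFinite] with ω hm hf b j
  have hl : IsLowerSet {j : ℕ | T j ω ≤ (b : ℝ≥0∞)} := fun i j hij hi =>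
    (monotone_nat_of_le_succ (f := fun j => T j ω) hm hij).trans hi
  have := Nat.eq_Iio_ncard_of_isLowerSet hl (hf b)
  exact Set.ext_iff.1 this j

theorem arrivalCount_zero (h : IsPoissonArrivals T Λ P) : ∀ᵐ ω ∂P, arrivalCount T 0 ω = 0 := by
  filter_upwards [h.pos] with ω hp
  have : {j : ℕ | T j ω ≤ ((0 : ℝ≥0) : ℝ≥0∞)} = ∅ := by
    ext j; simpa using (hp j).ne'
  rw [arrivalCount, this, Set.ncard_empty]

theorem lintegral_pow_increment (h : IsPoissonArrivals T Λ P) {a b : ℝ≥0} (hab : a ≤ b)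
    {c : ℝ} (hc : 0 ≤ c) :
    ∫⁻ ω, ENNReal.ofReal c ^ (arrivalCount T b ω - arrivalCount T a ω) ∂P
      = ENNReal.ofReal (Real.exp (Λ.real (Ioc (a : ℝ) b) * (c - 1))) := by
  have hm : Measurable fun ω => arrivalCount T b ω - arrivalCount T a ω :=
    (measurable_of_countable fun z : ℕ × ℕ => z.1 - z.2).comp
      ((h.measurable_arrivalCount b).prodMk (h.measurable_arrivalCount a))
  have := lintegral_pow_poissonMeasure (Λ (Ioc (a : ℝ) b)).toNNReal hc
  rw [← h.law a b hab, lintegral_map (measurable_of_countable _) hm] at this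
  exact this

theorem lintegral_prod_pow_increment (h : IsPoissonArrivals T Λ P) {t : ℕ → ℝ≥0}
    (ht : Monotone t) {c : ℕ → ℝ} (hc : ∀ i, 0 ≤ c i) (n : ℕ) :
    ∫⁻ ω, ∏ i ∈ Finset.range n,
        ENNReal.ofReal (c i) ^ (arrivalCount T (t (i + 1)) ω - arrivalCount T (t i) ω) ∂P
      = ENNReal.ofReal (Real.exp
          (∑ i ∈ Finset.range n, Λ.real (Ioc (t i : ℝ) (t (i + 1))) * (c i - 1))) := by
  -- Independence is stated for real differences and the law for truncated natural ones; `⌊·⌋₊`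
  -- carries the former to the latter, even where the difference is negative.
  have hg : ∀ i, Measurable fun x : ℝ => ENNReal.ofReal (c i) ^ ⌊x⌋₊ := fun i =>
    (measurable_of_countable fun n : ℕ => ENNReal.ofReal (c i) ^ n).comp Nat.measurable_floor
  have hi := (h.indep.nat ht).comp _ hg
  have hfl : ∀ a b : ℕ, ⌊(b : ℝ) - a⌋₊ = b - a := fun a b => by
    rw [Nat.floor_sub_natCast, Nat.floor_natCast]
  have e : ∀ i, (fun x : ℝ => ENNReal.ofReal (c i) ^ ⌊x⌋₊) ∘
      (fun ω => (arrivalCount T (t (i + 1)) ω : ℝ) - arrivalCount T (t i) ω)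
      = fun ω => ENNReal.ofReal (c i) ^ (arrivalCount T (t (i + 1)) ω - arrivalCount T (t i) ω) :=
    fun i => by ext ω; simp [hfl]
  simp_rw [e] at hi
  rw [lintegral_prod_eq_prod_lintegral_of_indepFun (Finset.range n) _ hi, Real.exp_sum,
    ENNReal.ofReal_prod_of_nonneg fun _ _ => (Real.exp_pos _).le]
  · exact Finset.prod_congr rfl fun i _ => h.lintegral_pow_increment (ht i.le_succ) (hc i)
  · intro i
    rw [← e i]
    refine (hg i).comp (Measurable.sub ?_ ?_)
    · exact (measurable_of_countable _).comp (h.measurable_arrivalCount _)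
    · exact (measurable_of_countable _).comp (h.measurable_arrivalCount _)

end IsPoissonArrivals

/-! ### The probability generating functional of the arrivals. -/

/-- The left endpoint of the cell `(i / n, (i + 1) / n]` that contains `v > 0`. -/
noncomputable def gridLeft (n : ℕ) (v : ℝ) : ℝ := ((⌈n * v⌉₊ : ℝ) - 1) / n

theorem measurable_gridLeft (n : ℕ) : Measurable (gridLeft n) := by
  unfold gridLeft
  have : Measurable fun v : ℝ => ⌈n * v⌉₊ := Nat.measurable_ceil.comp (measurable_const_mul _)
  have h2 : Measurable fun v : ℝ => (⌈n * v⌉₊ : ℝ) := (measurable_of_countable _).comp this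
  exact (h2.sub_const 1).div_const _

theorem gridLeft_eq {n i : ℕ} (hn : n ≠ 0) {v : ℝ} (hv : v ∈ Ioc ((i : ℝ) / n) ((i + 1 : ℕ) / n)) :
    gridLeft n v = i / n := by
  have hn' : (0 : ℝ) < n := by positivity
  have : ⌈n * v⌉₊ = i + 1 := by
    rw [Nat.ceil_eq_iff (by omega)]
    have h1 := (div_lt_iff₀ hn').1 hv.1
    have h2 := (le_div_iff₀ hn').1 hv.2
    push_cast at h2 ⊢
    constructor <;> linarith
  rw [gridLeft, this]; push_cast; ring

theorem tendsto_gridLeft {v : ℝ} (hv : 0 < v) :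
    Tendsto (fun n => gridLeft n v) atTop (𝓝[≤] v) := by
  have hbd : ∀ᶠ n : ℕ in atTop, gridLeft n v ≤ v ∧ v - 1 / n ≤ gridLeft n v := by
    filter_upwards [eventually_ge_atTop 1] with n hn
    have hn' : (0 : ℝ) < n := by exact_mod_cast hn
    have h1 := Nat.ceil_lt_add_one (a := (n : ℝ) * v) (by positivity)
    have h2 := Nat.le_ceil ((n : ℝ) * v)
    constructor
    · rw [gridLeft, div_le_iff₀ hn']; linarith
    · rw [gridLeft, le_div_iff₀ hn', sub_mul, one_div, inv_mul_cancel₀ hn'.ne']; linarith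
  rw [tendsto_nhdsWithin_iff]
  refine ⟨?_, hbd.mono fun n hn => hn.1⟩
  refine tendsto_of_tendsto_of_tendsto_of_le_of_le' (g := fun n : ℕ => v - 1 / (n : ℝ)) ?_
    (tendsto_const_nhds (x := v)) (hbd.mono fun n hn => hn.2) (hbd.mono fun n hn => hn.1)
  simpa using (tendsto_const_nhds (x := v)).sub tendsto_one_div_atTop_nhds_zero_nat

theorem Finset.prod_range_monotone {M : Type*} [CommMonoid M] (f : ℕ → M) {N : ℕ → ℕ}
    (hN : Monotone N) (h0 : N 0 = 0) (n : ℕ) :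
    ∏ k ∈ Finset.range (N n), f k
      = ∏ i ∈ Finset.range n, ∏ k ∈ Finset.Ico (N i) (N (i + 1)), f k := by
  induction n with
  | zero => simp [h0]
  | succ n ih =>
    rw [Finset.prod_range_succ, ← ih, Finset.prod_range_mul_prod_Ico _ (hN n.le_succ)]

namespace IsPoissonArrivals

variable {Ω : Type*} [MeasurableSpace Ω] {T : ℕ → Ω → ℝ≥0∞} {Λ : Measure ℝ} {P : Measure Ω}

theorem lintegral_prod_gridLeft [IsLocallyFiniteMeasure Λ] (h : IsPoissonArrivals T Λ P)
    {u : ℝ → ℝ} {C : ℝ} (hu0 : ∀ v, 0 ≤ u v) (huC : ∀ v, u v ≤ C) {n : ℕ} (hn : n ≠ 0) :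
    ∫⁻ ω, ∏ k ∈ Finset.range (arrivalCount T 1 ω),
        ENNReal.ofReal (u (gridLeft n (T k ω).toReal)) ∂P
      = ENNReal.ofReal (Real.exp (∫ v in Ioc 0 1, (u (gridLeft n v) - 1) ∂Λ)) := by
  have hn' : (0 : ℝ) < n := by positivity
  set t : ℕ → ℝ≥0 := fun i => (i : ℝ≥0) / n with htdef
  have ht : Monotone t := fun i j hij => by simp only [htdef]; gcongr
  have htc : ∀ i, (t i : ℝ) = (i : ℝ) / n := fun i => by simp [htdef]
  have htn : t n = 1 := by
    simp only [htdef]; exact div_self (by exact_mod_cast hn)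
  have hmeas : Measurable fun v => u (gridLeft n v) - 1 := by
    have : (fun v => u (gridLeft n v) - 1)
        = (fun m : ℕ => u (((m : ℝ) - 1) / n) - 1) ∘ fun v : ℝ => ⌈n * v⌉₊ := rfl
    rw [this]
    exact (measurable_of_countable _).comp (Nat.measurable_ceil.comp (measurable_const_mul _))
  have hint : ∀ a b : ℝ, IntervalIntegrable (fun v => u (gridLeft n v) - 1) Λ a b := by
    intro a b
    have hC : ∀ v, ‖u (gridLeft n v) - 1‖ ≤ C + 1 := fun v => by
      rw [Real.norm_eq_abs, abs_le]
      have := hu0 (gridLeft n v); have := huC (gridLeft n v)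
      constructor <;> linarith
    rw [intervalIntegrable_iff]
    have : IsFiniteMeasure (Λ.restrict (uIoc a b)) :=
      ⟨by simpa using (measure_mono uIoc_subset_uIcc).trans_lt isCompact_uIcc.measure_lt_top⟩
    exact Integrable.of_bound hmeas.aestronglyMeasurable _ (Eventually.of_forall hC)
  -- The integrand is constant on each grid cell, so the integral is a finite sum.
  have hI : ∫ v in Ioc 0 1, (u (gridLeft n v) - 1) ∂Λ
      = ∑ i ∈ Finset.range n, Λ.real (Ioc (t i : ℝ) (t (i + 1))) * (u ((i : ℝ) / n) - 1) := by
    rw [← intervalIntegral.integral_of_le zero_le_one]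
    have := intervalIntegral.sum_integral_adjacent_intervals (μ := Λ)
      (f := fun v => u (gridLeft n v) - 1) (a := fun i => (t i : ℝ)) (n := n)
      (fun k _ => hint _ _)
    rw [show ((t 0 : ℝ≥0) : ℝ) = 0 by simp [htdef], htn, NNReal.coe_one] at this
    rw [← this]
    refine Finset.sum_congr rfl fun i _ => ?_
    rw [intervalIntegral.integral_of_le (by exact_mod_cast ht i.le_succ)]
    rw [setIntegral_congr_fun (g := fun _ => u ((i : ℝ) / n) - 1) measurableSet_Ioc]
    · simp
    · intro v hv
      simp only [htc] at hv
      simp only [gridLeft_eq hn hv]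
  rw [hI, ← h.lintegral_prod_pow_increment ht (fun i => hu0 _) n]
  refine lintegral_congr_ae ?_
  filter_upwards [h.le_iff_lt_arrivalCount, h.arrivalCount_zero] with ω hω h0
  have hmono : Monotone fun i => arrivalCount T (t i) ω := fun i j hij => by
    by_contra hlt
    push Not at hlt
    have h1 := (hω (t i) _).2 hlt
    have h2 := (hω (t j) _).1 (h1.trans (by exact_mod_cast ht hij))
    exact lt_irrefl _ h2
  have h0' : arrivalCount T (t 0) ω = 0 := by simpa [htdef] using h0
  have := Finset.prod_range_monotone
    (fun k => ENNReal.ofReal (u (gridLeft n (T k ω).toReal))) hmono h0' n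
  simp only [htn] at this
  rw [this]
  -- The points in cell `i` have the indices from `N(i / n)` up to, but excluding, `N((i + 1) / n)`,
  -- and all of them contribute the factor `u (i / n)`.
  refine Finset.prod_congr rfl fun i _ => ?_
  rw [← Nat.card_Ico, ← Finset.prod_const]
  refine Finset.prod_congr rfl fun k hk => ?_
  rw [Finset.mem_Ico] at hk
  have h1 := not_le.1 (mt (hω (t i) k).1 (not_lt.2 hk.1))
  have h2 := (hω (t (i + 1)) k).2 hk.2
  rw [gridLeft_eq hn (i := i)]
  have htop : T k ω ≠ ∞ := ne_top_of_le_ne_top ENNReal.coe_ne_top h2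
  rw [← htc, ← htc]
  lift T k ω to ℝ≥0 using htop with x
  exact ⟨by exact_mod_cast h1, by exact_mod_cast h2⟩

theorem lintegral_pow_arrivalCount_one (h : IsPoissonArrivals T Λ P) {c : ℝ} (hc : 0 ≤ c) :
    ∫⁻ ω, ENNReal.ofReal c ^ arrivalCount T 1 ω ∂P
      = ENNReal.ofReal (Real.exp (Λ.real (Ioc 0 1) * (c - 1))) := by
  have := h.lintegral_pow_increment (zero_le_one : (0 : ℝ≥0) ≤ 1) hc
  simp only [NNReal.coe_zero, NNReal.coe_one] at this
  rw [← this]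
  refine lintegral_congr_ae ?_
  filter_upwards [h.arrivalCount_zero] with ω h0
  rw [h0, Nat.sub_zero]

/-- The probability generating functional of a Poisson process at a bounded left-continuous
function. -/
theorem lintegral_prod [IsLocallyFiniteMeasure Λ] (h : IsPoissonArrivals T Λ P)
    {u : ℝ → ℝ} {C : ℝ} (hu0 : ∀ v, 0 ≤ u v) (huC : ∀ v, u v ≤ C)
    (hum : Measurable u) (huc : ∀ v, ContinuousWithinAt u (Iic v) v) :
    ∫⁻ ω, ∏ k ∈ Finset.range (arrivalCount T 1 ω), ENNReal.ofReal (u (T k ω).toReal) ∂P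
      = ENNReal.ofReal (Real.exp (∫ v in Ioc 0 1, (u v - 1) ∂Λ)) := by
  have hlim : ∀ v, 0 < v → Tendsto (fun n => u (gridLeft n v)) atTop (𝓝 (u v)) := fun v hv =>
    (huc v).tendsto.comp (tendsto_gridLeft hv)
  have hL : Tendsto (fun n => ∫⁻ ω, ∏ k ∈ Finset.range (arrivalCount T 1 ω),
        ENNReal.ofReal (u (gridLeft n (T k ω).toReal)) ∂P) atTop
      (𝓝 (∫⁻ ω, ∏ k ∈ Finset.range (arrivalCount T 1 ω),
        ENNReal.ofReal (u (T k ω).toReal) ∂P)) := by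
    -- The dominating variable `C ^ N(1)` is integrable by the Poisson generating function.
    refine tendsto_lintegral_of_dominated_convergence
      (fun ω => ENNReal.ofReal C ^ arrivalCount T 1 ω) (fun n => ?_) (fun n => ?_) ?_ ?_
    · refine Measurable.apply_nat
        (f := fun m ω => ∏ k ∈ Finset.range m, ENNReal.ofReal (u (gridLeft n (T k ω).toReal)))
        (fun m => ?_) (h.measurable_arrivalCount 1)
      refine Finset.measurable_fun_prod _ fun k _ => ENNReal.measurable_ofReal.comp ?_
      exact hum.comp ((measurable_gridLeft n).comp (h.measurable k).ennreal_toReal)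
    · refine Eventually.of_forall fun ω => ?_
      calc _ ≤ ∏ k ∈ Finset.range (arrivalCount T 1 ω), ENNReal.ofReal C :=
            Finset.prod_le_prod' fun k _ => ENNReal.ofReal_le_ofReal (huC _)
        _ = _ := by simp
    · rw [h.lintegral_pow_arrivalCount_one ((hu0 0).trans (huC 0))]
      exact ENNReal.ofReal_ne_top
    · filter_upwards [h.le_iff_lt_arrivalCount, h.pos] with ω hω hp
      refine ENNReal.tendsto_finsetProd_of_ne_top _ (fun k hk => ?_) (fun k hk => by simp)
      refine ENNReal.tendsto_ofReal (hlim _ (ENNReal.toReal_pos (hp k).ne' ?_))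
      exact ne_top_of_le_ne_top ENNReal.coe_ne_top ((hω 1 k).2 (Finset.mem_range.1 hk))
  have hfin : IsFiniteMeasure (Λ.restrict (Ioc 0 1)) :=
    ⟨by simpa using (measure_mono Ioc_subset_Icc_self).trans_lt isCompact_Icc.measure_lt_top⟩
  have hR : Tendsto (fun n => ∫ v in Ioc 0 1, (u (gridLeft n v) - 1) ∂Λ) atTop
      (𝓝 (∫ v in Ioc 0 1, (u v - 1) ∂Λ)) := by
    refine tendsto_integral_of_dominated_convergence (fun _ => C + 1) (fun n => ?_)
      (integrable_const _) (fun n => Eventually.of_forall fun v => ?_) ?_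
    · exact ((hum.comp (measurable_gridLeft n)).sub_const 1).aestronglyMeasurable
    · rw [Real.norm_eq_abs, abs_le]
      have := hu0 (gridLeft n v); have := huC (gridLeft n v)
      constructor <;> linarith
    · filter_upwards [ae_restrict_mem measurableSet_Ioc] with v hv
      exact (hlim v hv.1).sub_const 1
  refine tendsto_nhds_unique hL ?_
  refine (ENNReal.tendsto_ofReal ((Real.continuous_exp.tendsto _).comp hR)).congr' ?_
  filter_upwards [eventually_ne_atTop 0] with n hn
  exact (h.lintegral_prod_gridLeft hu0 huC hn).symm

end IsPoissonArrivals

/-! ### Integrating out independent marks. -/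

section Independence

variable {Ω : Type*} [MeasurableSpace Ω] {P : Measure Ω} [IsProbabilityMeasure P]

theorem ProbabilityTheory.IndepFun.lintegral_comp_prod {α β : Type*} [MeasurableSpace α]
    [MeasurableSpace β] {X : Ω → α} {Y : Ω → β} (h : IndepFun X Y P) (hX : Measurable X)
    (hY : Measurable Y) {F : α × β → ℝ≥0∞} (hF : Measurable F) :
    ∫⁻ ω, F (X ω, Y ω) ∂P = ∫⁻ ω, ∫⁻ ω', F (X ω, Y ω') ∂P ∂P := by
  have h1 := (indepFun_iff_map_prod_eq_prod_map_map hX.aemeasurable hY.aemeasurable).1 h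
  rw [← lintegral_map hF (hX.prodMk hY), h1,
    MeasureTheory.lintegral_prod _ hF.aemeasurable, lintegral_map _ hX]
  · refine lintegral_congr fun ω => ?_
    rw [lintegral_map _ hY]
    exact hF.comp measurable_prodMk_left
  · exact hF.lintegral_prod_right'

theorem ProbabilityTheory.iIndepFun.lintegral_prod_comp {Ω : Type*} [MeasurableSpace Ω]
    {P : Measure Ω} {β : Type*} [MeasurableSpace β]
    {Y : ℕ → Ω → β} (h : iIndepFun Y P) (hY : ∀ k, Measurable (Y k)) {g : ℕ → β → ℝ≥0∞}
    (hg : ∀ k, Measurable (g k)) (n : ℕ) :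
    ∫⁻ ω, ∏ k ∈ Finset.range n, g k (Y k ω) ∂P
      = ∏ k ∈ Finset.range n, ∫⁻ ω, g k (Y k ω) ∂P :=
  lintegral_prod_eq_prod_lintegral_of_indepFun _ _ (h.comp g hg) fun k => (hg k).comp (hY k)

theorem measurable_finset_prod_range {α : Type*} [MeasurableSpace α] {N : α → ℕ}
    (hN : Measurable N) {g : ℕ → α → ℝ≥0∞} (hg : ∀ k, Measurable (g k)) :
    Measurable fun a => ∏ k ∈ Finset.range (N a), g k a :=
  Measurable.apply_nat (f := fun n a => ∏ k ∈ Finset.range n, g k a)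
    (fun _ => Finset.measurable_fun_prod _ fun k _ => hg k) hN

/-- The marks of a marked sequence of random length can be integrated out. -/
theorem lintegral_prod_marks {α β γ : Type*} [MeasurableSpace α] [MeasurableSpace β]
    [MeasurableSpace γ] {T : ℕ → Ω → α} {D : ℕ → Ω → β} {L : ℕ → Ω → γ}
    (hT : ∀ k, Measurable (T k)) (hD : ∀ k, Measurable (D k)) (hL : ∀ k, Measurable (L k))
    (hDi : iIndepFun D P) (hLi : iIndepFun L P)
    (hTL : IndepFun (fun ω k => T k ω) (fun ω k => L k ω) P)
    (hDTL : IndepFun (fun ω k => D k ω) (fun ω => ((fun k => T k ω), (fun k => L k ω))) P)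
    {ν : Measure β} (hDν : ∀ k, P.map (D k) = ν)
    {N : (ℕ → α) → ℕ} (hN : Measurable N)
    {h : α × β × γ → ℝ≥0∞} (hh : Measurable h) {g : α × β → ℝ≥0∞} (hg : Measurable g)
    (hgh : ∀ k a b, ∫⁻ ω, h (a, b, L k ω) ∂P = g (a, b)) :
    ∫⁻ ω, ∏ k ∈ Finset.range (N fun k => T k ω), h (T k ω, D k ω, L k ω) ∂P
      = ∫⁻ ω, ∏ k ∈ Finset.range (N fun k => T k ω), ∫⁻ b, g (T k ω, b) ∂ν ∂P := by
  have hT' : Measurable fun ω k => T k ω := measurable_pi_lambda _ hT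
  have hD' : Measurable fun ω k => D k ω := measurable_pi_lambda _ hD
  have hL' : Measurable fun ω k => L k ω := measurable_pi_lambda _ hL
  have hF1 : Measurable fun z : (ℕ → β) × ((ℕ → α) × (ℕ → γ)) =>
      ∏ k ∈ Finset.range (N z.2.1), h (z.2.1 k, z.1 k, z.2.2 k) := by
    refine measurable_finset_prod_range (hN.comp (by fun_prop)) fun k => hh.comp ?_
    fun_prop
  have hF2 : ∀ d : ℕ → β, Measurable fun z : (ℕ → α) × (ℕ → γ) =>
      ∏ k ∈ Finset.range (N z.1), h (z.1 k, d k, z.2 k) := fun d =>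
    hF1.comp measurable_prodMk_left
  have e1 := hDTL.lintegral_comp_prod hD' (hT'.prodMk hL') hF1
  have e2 : ∀ d : ℕ → β, _ := fun d => hTL.lintegral_comp_prod hT' hL' (hF2 d)
  simp only at e1 e2
  rw [e1]
  simp_rw [e2]
  have e3 : ∀ ω ω', ∫⁻ ω'', ∏ k ∈ Finset.range (N fun k => T k ω'),
        h (T k ω', D k ω, L k ω'') ∂P
      = ∏ k ∈ Finset.range (N fun k => T k ω'), g (T k ω', D k ω) := fun ω ω' => by
    rw [hLi.lintegral_prod_comp hL (g := fun k c => h (T k ω', D k ω, c))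
      fun k => hh.comp (by fun_prop)]
    simp_rw [hgh]
  simp_rw [e3]
  -- The clusters are gone; the swap freezes the arrivals, hence the number of factors, while the
  -- delays are integrated.
  rw [lintegral_lintegral_swap]
  · refine lintegral_congr fun ω' => ?_
    rw [hDi.lintegral_prod_comp hD (g := fun k b => g (T k ω', b)) fun k => hg.comp (by fun_prop)]
    refine Finset.prod_congr rfl fun k _ => ?_
    rw [← hDν k]
    exact (lintegral_map (f := fun b => g (T k ω', b)) (hg.comp measurable_prodMk_left) (hD k)).symm
  · refine (measurable_finset_prod_range (N := fun z : Ω × Ω => N fun k => T k z.2)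
      (hN.comp (hT'.comp measurable_snd)) fun k => hg.comp ?_).aemeasurable
    exact ((hT k).comp measurable_snd).prodMk ((hD k).comp measurable_fst)

end Independence

/-! ### Measurable evaluation of paths at random times. -/

/-- Evaluation of a path at a point through its values on a countable grid to the right; it is
jointly measurable, and agrees with the usual evaluation where the path is right-continuous. -/
noncomputable def rightEval (f : ℝ → ℝ) (x : ℝ) : ℝ :=
  (limsup (fun n : ℕ => (f ((⌊((n : ℝ) + 1) * x⌋ + 1) / ((n : ℝ) + 1)) : EReal)) atTop).toReal

theorem measurable_rightEval : Measurable fun z : (ℝ → ℝ) × ℝ => rightEval z.1 z.2 := by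
  unfold rightEval
  refine measurable_ereal_toReal.comp (Measurable.limsup fun n => ?_)
  refine measurable_coe_real_ereal.comp ?_
  have h1 : Measurable fun z : ℤ × (ℝ → ℝ) => z.2 (((z.1 : ℝ) + 1) / ((n : ℝ) + 1)) :=
    measurable_from_prod_countable_right fun i =>
      measurable_pi_apply (((i : ℝ) + 1) / ((n : ℝ) + 1))
  exact h1.comp ((Int.measurable_floor.comp (measurable_snd.const_mul _)).prodMk measurable_fst)

theorem rightEval_eq {f : ℝ → ℝ} {x : ℝ} (h : ContinuousWithinAt f (Ici x) x) :
    rightEval f x = f x := by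
  have hx : Tendsto (fun n : ℕ => ((⌊((n : ℝ) + 1) * x⌋ : ℝ) + 1) / ((n : ℝ) + 1)) atTop
      (𝓝[≥] x) := by
    have hb : ∀ n : ℕ, x ≤ ((⌊((n : ℝ) + 1) * x⌋ : ℝ) + 1) / ((n : ℝ) + 1) ∧
        ((⌊((n : ℝ) + 1) * x⌋ : ℝ) + 1) / ((n : ℝ) + 1) ≤ x + 1 / ((n : ℝ) + 1) := by
      intro n
      have hn : (0 : ℝ) < (n : ℝ) + 1 := by positivity
      have h1 := Int.lt_floor_add_one (((n : ℝ) + 1) * x)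
      have h2 := Int.floor_le (((n : ℝ) + 1) * x)
      constructor
      · rw [le_div_iff₀ hn]; linarith
      · rw [div_le_iff₀ hn, add_mul x, one_div, inv_mul_cancel₀ hn.ne']; linarith
    rw [tendsto_nhdsWithin_iff]
    refine ⟨tendsto_of_tendsto_of_tendsto_of_le_of_le tendsto_const_nhds ?_
      (fun n => (hb n).1) fun n => (hb n).2, Eventually.of_forall fun n => (hb n).1⟩
    simpa using (tendsto_const_nhds (x := x)).add tendsto_one_div_add_atTop_nhds_zero_nat
  have h2 := (continuous_coe_real_ereal.tendsto (f x)).comp (h.tendsto.comp hx)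
  exact (congrArg EReal.toReal h2.limsup_eq).trans (EReal.toReal_coe _)

attribute [irreducible] rightEval

theorem measurable_rightEval_comp {α : Type*} [MeasurableSpace α] {f : α → ℝ → ℝ} {g : α → ℝ}
    (hf : Measurable f) (hg : Measurable g) : Measurable fun a => rightEval (f a) (g a) :=
  measurable_rightEval.comp (hf.prodMk hg)

/-! ### Elementary symmetric functions and exponential coefficients. -/

/-- The elementary symmetric functions of the first `n` terms of a sequence in `ℝ≥0∞`. -/
noncomputable def esymmSeq (φ : ℕ → ℝ≥0∞) : ℕ → ℕ → ℝ≥0∞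
  | 0, 0 => 1
  | 0, _ + 1 => 0
  | n + 1, 0 => esymmSeq φ n 0
  | n + 1, i + 1 => esymmSeq φ n (i + 1) + φ n * esymmSeq φ n i

theorem tsum_esymmSeq_mul_pow (φ : ℕ → ℝ≥0∞) (y : ℝ≥0∞) (n : ℕ) :
    ∑' i, esymmSeq φ n i * y ^ i = ∏ k ∈ Finset.range n, (1 + y * φ k) := by
  induction n with
  | zero =>
    rw [tsum_eq_single 0]
    · simp [esymmSeq]
    · intro i hi
      obtain ⟨i, rfl⟩ := Nat.exists_eq_succ_of_ne_zero hi
      simp [esymmSeq]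
  | succ n ih =>
    rw [Finset.prod_range_succ, ← ih, tsum_eq_zero_add' ENNReal.summable]
    simp only [esymmSeq, add_mul]
    rw [ENNReal.tsum_add, ← add_assoc, mul_add, mul_one, ← ENNReal.tsum_mul_right]
    congr 1
    · rw [tsum_eq_zero_add' (f := fun i => esymmSeq φ n i * y ^ i) ENNReal.summable]
    · refine tsum_congr fun i => ?_
      rw [pow_succ]; ring

theorem esymmSeq_zero (φ : ℕ → ℝ≥0∞) (n : ℕ) : esymmSeq φ n 0 = 1 := by
  induction n with
  | zero => rfl
  | succ n ih => rw [esymmSeq, ih]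

theorem esymmSeq_one (φ : ℕ → ℝ≥0∞) (n : ℕ) : esymmSeq φ n 1 = ∑ k ∈ Finset.range n, φ k := by
  induction n with
  | zero => rfl
  | succ n ih => rw [esymmSeq, ih, esymmSeq_zero, Finset.sum_range_succ, mul_one]

theorem sq_sum_eq_esymmSeq (φ : ℕ → ℝ≥0∞) (n : ℕ) :
    (∑ k ∈ Finset.range n, φ k) ^ 2
      = ∑ k ∈ Finset.range n, φ k ^ 2 + 2 * esymmSeq φ n 2 := by
  induction n with
  | zero => simp [esymmSeq]
  | succ n ih =>
    rw [Finset.sum_range_succ, add_sq, ih, Finset.sum_range_succ, esymmSeq, esymmSeq_one]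
    ring

theorem measurable_esymmSeq {α : Type*} [MeasurableSpace α] {φ : ℕ → α → ℝ≥0∞}
    (hφ : ∀ k, Measurable (φ k)) (n i : ℕ) : Measurable fun a => esymmSeq (fun k => φ k a) n i := by
  induction n generalizing i with
  | zero => cases i <;> exact measurable_const
  | succ n ih =>
    cases i with
    | zero => exact ih 0
    | succ i => exact (ih (i + 1)).add ((hφ n).mul (ih i))

/-- The coefficient of `z ^ l` in `z ^ i * exp (a * z)`. -/
noncomputable def expCoeff (a : ℝ) (i l : ℕ) : ℝ :=
  (l.descFactorial i : ℝ) * a ^ (l - i) / l.factorial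

theorem hasSum_expCoeff (a z : ℝ) (i : ℕ) :
    HasSum (fun l => expCoeff a i l * z ^ l) (z ^ i * Real.exp (a * z)) := by
  have h0 : HasSum (fun l : ℕ => a ^ l / l.factorial * z ^ l) (Real.exp (a * z)) := by
    have := NormedSpace.expSeries_div_hasSum_exp (𝔸 := ℝ) (a * z)
    rw [← Real.exp_eq_exp_ℝ] at this
    refine (funext fun n => ?_ : (fun n : ℕ => _) = _) ▸ this
    rw [mul_pow]; ring
  rw [← hasSum_nat_add_iff' i, Finset.sum_eq_zero, sub_zero]
  · refine (funext fun l => ?_ : (fun n : ℕ => _) = _) ▸ h0.mul_left (z ^ i)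
    have h1 := Nat.factorial_mul_descFactorial (Nat.le_add_left i l)
    rw [Nat.add_sub_cancel] at h1
    have h2 : ((l.factorial : ℝ) * (l + i).descFactorial i) = (l + i).factorial := by
      exact_mod_cast h1
    rw [expCoeff, Nat.add_sub_cancel, ← h2, pow_add]
    have h3 : ((l + i).descFactorial i : ℝ) ≠ 0 := by
      have := Nat.pow_sub_le_descFactorial (l + i) i
      have : 0 < (l + i).descFactorial i := Nat.descFactorial_pos.2 (Nat.le_add_left i l)
      positivity
    field_simp
  · intro l hl
    rw [expCoeff, Nat.descFactorial_of_lt (Finset.mem_range.1 hl)]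
    simp

/-- Relative to the Poisson weight `expCoeff a 0 l`, a factor `z` costs `l / a`; the multiplied form
also covers `a = 0`. -/
theorem mul_expCoeff_one (a : ℝ) (l : ℕ) : a * expCoeff a 1 l = l * expCoeff a 0 l := by
  cases l with
  | zero => simp [expCoeff]
  | succ l => simp [expCoeff, pow_succ]; ring

theorem sq_mul_expCoeff_two (a : ℝ) (l : ℕ) :
    a ^ 2 * expCoeff a 2 l = l * (l - 1) * expCoeff a 0 l := by
  rcases l with _ | _ | l
  · simp [expCoeff]
  · simp [expCoeff]
  · simp [expCoeff, pow_succ, Nat.descFactorial_succ]; ring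

/-! ### Coefficient extraction from the generating functional. -/

section Extraction

variable {Ω : Type*} [MeasurableSpace Ω] {P : Measure Ω} {N : Ω → ℕ} {A : ℕ → Ω → Prop}
  {φ : ℕ → Ω → ℝ≥0∞} {a b₀ b₁ : ℝ}

open Classical in
/-- The number of indices `k < N` for which `A k` holds. -/
noncomputable def markedCount (N : Ω → ℕ) (A : ℕ → Ω → Prop) (ω : Ω) : ℕ :=
  ∑ k ∈ Finset.range (N ω), if A k ω then 1 else 0

open Classical in
theorem prod_ite_eq_pow_markedCount {Ω : Type*} {N : Ω → ℕ} {A : ℕ → Ω → Prop} (z : ℝ≥0∞) (ω : Ω) :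
    ∏ k ∈ Finset.range (N ω), (if A k ω then z else 1) = z ^ markedCount N A ω := by
  rw [markedCount, ← Finset.prod_pow_eq_pow_sum]
  exact Finset.prod_congr rfl fun k _ => by split_ifs <;> simp

theorem measurable_markedCount (hN : Measurable N) (hA : ∀ k, MeasurableSet {ω | A k ω}) :
    Measurable (markedCount N A) := by
  classical
  refine Measurable.apply_nat (f := fun n ω => ∑ k ∈ Finset.range n, if A k ω then 1 else 0)
    (fun n => ?_) hN
  exact Finset.measurable_fun_sum _ fun k _ => Measurable.ite (hA k) measurable_const measurable_const

open Classical in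
/-- Identification of the factorial moments of the marks on the event that a given number of
points are of the first kind, from the probability generating functional. -/
theorem setLIntegral_esymmSeq (hN : Measurable N) (hA : ∀ k, MeasurableSet {ω | A k ω})
    (hφ : ∀ k, Measurable (φ k)) (hb₀ : 0 ≤ b₀) (hb₁ : 0 ≤ b₁)
    (H : ∀ x ∈ Icc (0 : ℝ) 1, ∀ z ∈ Icc (0 : ℝ) 1,
      ∫⁻ ω, ∏ k ∈ Finset.range (N ω), ((if A k ω then ENNReal.ofReal z else 1)
          * (1 + ENNReal.ofReal x * φ k ω)) ∂P
        = ENNReal.ofReal (Real.exp ((z - 1) * a + x * (b₀ + z * b₁))))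
    (i : ℕ) {d : ℕ → ℝ} (hd : ∀ z ∈ Icc (0 : ℝ) 1,
      HasSum (fun l => d l * z ^ l) (Real.exp ((z - 1) * a) * ((b₀ + z * b₁) ^ i / i.factorial)))
    (l : ℕ) :
    ∫⁻ ω in {ω | markedCount N A ω = l}, esymmSeq (fun k => φ k ω) (N ω) i ∂P
      = ENNReal.ofReal (d l) := by
  have hM := measurable_markedCount hN hA
  have he : ∀ i, Measurable fun ω => esymmSeq (fun k => φ k ω) (N ω) i := fun i =>
    Measurable.apply_nat (f := fun n ω => esymmSeq (fun k => φ k ω) n i)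
      (fun n => measurable_esymmSeq hφ n i) hN
  -- With `z` fixed, coefficients in `x` are compared first; those in `z` are compared afterwards.
  have hx : ∀ z ∈ Icc (0 : ℝ) 1, ∀ i,
      ∫⁻ ω, esymmSeq (fun k => φ k ω) (N ω) i * ENNReal.ofReal z ^ markedCount N A ω ∂P
        = ENNReal.ofReal (Real.exp ((z - 1) * a) * ((b₀ + z * b₁) ^ i / i.factorial)) := by
    intro z hz i
    refine ENNReal.coeff_eq_of_tsum_eq (c := fun i => ∫⁻ ω, esymmSeq (fun k => φ k ω) (N ω) i
        * ENNReal.ofReal z ^ markedCount N A ω ∂P)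
      (d := fun i => Real.exp ((z - 1) * a) * ((b₀ + z * b₁) ^ i / i.factorial))
      (f := fun x => Real.exp ((z - 1) * a + x * (b₀ + z * b₁))) (fun x hx => ?_) (fun x hx => ?_)
      (fun x _ => (Real.exp_pos _).le) i
    · rw [← H x hx z hz]
      have hzM : Measurable fun ω => ENNReal.ofReal z ^ markedCount N A ω :=
        (measurable_of_countable fun n : ℕ => ENNReal.ofReal z ^ n).comp hM
      have hm : ∀ i, Measurable fun ω =>
          esymmSeq (fun k => φ k ω) (N ω) i * ENNReal.ofReal z ^ markedCount N A ω := fun i =>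
        (he i).mul hzM
      have hmul := fun i => (lintegral_mul_const (μ := P) (ENNReal.ofReal x ^ i)
        (hm i)).symm
      simp_rw [hmul]
      rw [← lintegral_tsum fun i => ((hm i).mul_const _).aemeasurable]
      refine lintegral_congr fun ω => ?_
      rw [Finset.prod_mul_distrib, prod_ite_eq_pow_markedCount, ← tsum_esymmSeq_mul_pow,
        ← ENNReal.tsum_mul_left]
      exact tsum_congr fun i => by ring
    · have := (NormedSpace.expSeries_div_hasSum_exp (𝔸 := ℝ) (x * (b₀ + z * b₁))).mul_left
        (Real.exp ((z - 1) * a))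
      rw [← Real.exp_eq_exp_ℝ, ← Real.exp_add] at this
      refine (funext fun n => ?_ : (fun n : ℕ => _) = _) ▸ this
      rw [mul_pow]; ring
  refine ENNReal.coeff_eq_of_tsum_eq (c := fun l => ∫⁻ ω in {ω | markedCount N A ω = l},
      esymmSeq (fun k => φ k ω) (N ω) i ∂P) (d := d)
    (f := fun z => Real.exp ((z - 1) * a) * ((b₀ + z * b₁) ^ i / i.factorial)) (fun z hz => ?_) hd
    (fun z hz => ?_) l
  · rw [← hx z hz i]
    have hms : ∀ l, MeasurableSet {ω | markedCount N A ω = l} := fun l =>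
      hM (measurableSet_singleton l)
    -- Splitting the integral over the values of the count displays it as a power series in `z`.
    have hun : (⋃ l, {ω | markedCount N A ω = l}) = univ := by ext; simp
    rw [← setLIntegral_univ, ← hun, lintegral_iUnion hms]
    · refine tsum_congr fun l => ?_
      rw [← lintegral_mul_const _ (he i)]
      exact setLIntegral_congr_fun (hms l) fun ω hω => by
        simp only [mem_ofPred_eq] at hω
        simp only [hω]
    · intro l l' hll
      exact Set.disjoint_left.2 fun ω h1 h2 => hll (h1.symm.trans h2)
  · have := hz.1
    positivity

end Extraction

/-! ### Integer-valued variables and the law of a cluster. -/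

section NatValued

variable {Ω : Type*} [MeasurableSpace Ω] {P : Measure Ω} [IsProbabilityMeasure P]
  {Z : Ω → ℝ} {w : ℕ → ℝ}

/-- The point masses at the natural numbers already exhaust the total mass `1`. -/
theorem ae_exists_natCast_eq (hZ : Measurable Z) (hw : HasSum w 1)
    (hZw : ∀ k : ℕ, P.real {ω | Z ω = k} = w k) : ∀ᵐ ω ∂P, ∃ k : ℕ, Z ω = k := by
  have hms : ∀ k : ℕ, MeasurableSet {ω | Z ω = k} := fun k => hZ (measurableSet_singleton _)
  have hd : Pairwise (Function.onFun Disjoint fun k : ℕ => {ω | Z ω = k}) := fun i j hij =>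
    Set.disjoint_left.2 fun ω h1 h2 => hij (by exact_mod_cast h1.symm.trans h2)
  have h1 : P (⋃ k : ℕ, {ω | Z ω = k}) = 1 := by
    rw [measure_iUnion hd hms, ← ENNReal.ofReal_one, ← hw.tsum_eq,
      ENNReal.ofReal_tsum_of_nonneg (fun k => by rw [← hZw]; exact measureReal_nonneg) hw.summable]
    refine tsum_congr fun k => ?_
    rw [← hZw, ofReal_measureReal]
  have h2 := (prob_compl_eq_zero_iff (MeasurableSet.iUnion hms)).2 h1
  refine (ae_iff.2 ?_)
  convert h2 using 2
  ext ω; simp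

theorem lintegral_comp_natValued (hZ : Measurable Z) (hw : HasSum w 1)
    (hZw : ∀ k : ℕ, P.real {ω | Z ω = k} = w k) (F : ℝ → ℝ≥0∞) :
    ∫⁻ ω, F (Z ω) ∂P = ∑' k : ℕ, F k * ENNReal.ofReal (w k) := by
  have hms : ∀ k : ℕ, MeasurableSet {ω | Z ω = k} := fun k => hZ (measurableSet_singleton _)
  have hd : Pairwise (Function.onFun Disjoint fun k : ℕ => {ω | Z ω = k}) := fun i j hij =>
    Set.disjoint_left.2 fun ω h1 h2 => hij (by exact_mod_cast h1.symm.trans h2)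
  have hae : (⋃ k : ℕ, {ω | Z ω = k}) =ᵐ[P] (univ : Set Ω) := by
    rw [eventuallyEq_univ]
    filter_upwards [ae_exists_natCast_eq hZ hw hZw] with ω hω
    simpa using hω
  rw [← setLIntegral_univ, ← Measure.restrict_congr_set hae, lintegral_iUnion hms hd]
  refine tsum_congr fun k => ?_
  rw [setLIntegral_congr_fun (g := fun _ => F k) (hms k)
    (fun ω hω => by rw [mem_ofPred_eq] at hω; simp only [hω]), setLIntegral_const, ← hZw,
    ofReal_measureReal]

end NatValued

theorem negBinomialPMF_tsum_ofReal {r p m : ℝ} {j : ℕ} (hr : 0 ≤ r) (hp0 : 0 < p) (hp1 : p < 1)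
    (h : HasSum (fun k : ℕ => (k : ℝ) ^ j * negBinomialPMF r p k) m) :
    ∑' k : ℕ, ENNReal.ofReal (k : ℝ) ^ j * ENNReal.ofReal (negBinomialPMF r p k)
      = ENNReal.ofReal m := by
  have hn : ∀ k : ℕ, 0 ≤ (k : ℝ) ^ j * negBinomialPMF r p k := fun k =>
    mul_nonneg (by positivity) (negBinomialPMF_nonneg hr hp0 hp1 k)
  rw [← h.tsum_eq, ENNReal.ofReal_tsum_of_nonneg hn h.summable]
  refine tsum_congr fun k => ?_
  rw [ENNReal.ofReal_mul (by positivity), ENNReal.ofReal_pow (by positivity)]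

namespace IsNegBinomialProcess

variable {Ω : Type*} [MeasurableSpace Ω] {P : Measure Ω} [IsProbabilityMeasure P]
  {X : ℝ → Ω → ℝ} {μ : ℝ → ℝ} {p : ℝ}

theorem lintegral_ofReal_increment_pow (h : IsNegBinomialProcess X μ p P) (hμ : Monotone μ)
    (hp0 : 0 < p) (hp1 : p < 1) {a b : ℝ} (hab : a ≤ b) {j : ℕ} {m : ℝ}
    (hm : HasSum (fun k : ℕ => (k : ℝ) ^ j * negBinomialPMF (μ b - μ a) p k) m) :
    ∫⁻ ω, ENNReal.ofReal (X b ω - X a ω) ^ j ∂P = ENNReal.ofReal m := by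
  rw [lintegral_comp_natValued (Z := fun ω => X b ω - X a ω)
    ((h.measurable b).sub (h.measurable a)) (hasSum_negBinomialPMF _ hp0 hp1) (h.law a b hab)
    fun y => ENNReal.ofReal y ^ j]
  exact negBinomialPMF_tsum_ofReal (sub_nonneg.2 (hμ hab)) hp0 hp1 hm

/-- Increments between rational times are almost surely natural numbers, simultaneously for all
pairs, and right-continuity extends the order to real times. Increments over random intervals need
this. -/
theorem ae_monotone (h : IsNegBinomialProcess X μ p P) (hp0 : 0 < p) (hp1 : p < 1) :
    ∀ᵐ ω ∂P, Monotone fun t => X t ω := by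
  have h1 : ∀ᵐ ω ∂P, ∀ a b : ℚ, a ≤ b → X a ω ≤ X b ω := by
    rw [ae_all_iff]; intro a
    rw [ae_all_iff]; intro b
    by_cases hab : a ≤ b
    · have hab' : (a : ℝ) ≤ b := by exact_mod_cast hab
      filter_upwards [ae_exists_natCast_eq ((h.measurable b).sub (h.measurable a))
        (hasSum_negBinomialPMF _ hp0 hp1) (h.law a b hab')] with ω hω _
      obtain ⟨k, hk⟩ := hω
      have : (0 : ℝ) ≤ k := by positivity
      simp only [Pi.sub_apply] at hk
      linarith
    · exact Eventually.of_forall fun ω hab' => absurd hab' hab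
  filter_upwards [h1, h.cadlag] with ω hω hc a b hab
  rcases hab.eq_or_lt with rfl | hlt
  · exact le_rfl
  have hseq : ∀ x : ℝ, ∃ q : ℕ → ℚ, (∀ n, x < q n) ∧ Tendsto (fun n => X (q n) ω) atTop (𝓝 (X x ω)) ∧
      Tendsto (fun n => ((q n : ℚ) : ℝ)) atTop (𝓝 x) := by
    intro x
    obtain ⟨q, -, hq, hq2⟩ := Real.exists_seq_rat_strictAnti_tendsto x
    refine ⟨q, hq, ((hc x).1.tendsto).comp ?_, hq2⟩
    exact tendsto_nhdsWithin_iff.2 ⟨hq2, Eventually.of_forall fun n => (hq n).le⟩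
  obtain ⟨q, hqa, hqX, hqt⟩ := hseq a
  obtain ⟨q', hqb, hqX', -⟩ := hseq b
  refine le_of_tendsto_of_tendsto hqX hqX' ?_
  filter_upwards [hqt.eventually (gt_mem_nhds hlt)] with n hn
  exact hω _ _ (by exact_mod_cast (hn.trans (hqb n)).le)

end IsNegBinomialProcess

/-! ### The generating functional with delays. -/

namespace IsPoissonArrivals

variable {Ω : Type*} [MeasurableSpace Ω] {T : ℕ → Ω → ℝ≥0∞} {Λ F : Measure ℝ} {P : Measure Ω}

/-- The delay average `v ↦ ∫ g (v + r) F(dr)` inherits the bound of `g` and, by dominated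
convergence, its left-continuity. Integrating it against `Λ` on `[0, 1]` is integrating `g` against
the convolution; absence of an atom at `0` reconciles `(0, 1]` with `[0, 1]`. -/
theorem lintegral_prod_conv [IsLocallyFiniteMeasure Λ] [NullSingletonClass Λ] [IsProbabilityMeasure F]
    (h : IsPoissonArrivals T Λ P) {g : ℝ → ℝ} {C : ℝ} (hg0 : ∀ v, 0 ≤ g v) (hgC : ∀ v, g v ≤ C)
    (hgm : Measurable g) (hgc : ∀ v, ContinuousWithinAt g (Iic v) v) :
    ∫⁻ ω, ∏ k ∈ Finset.range (arrivalCount T 1 ω),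
        ∫⁻ r, ENNReal.ofReal (g ((T k ω).toReal + r)) ∂F ∂P
      = ENNReal.ofReal (Real.exp (∫ w, (g w - 1) ∂(reportMeasure Λ F))) := by
  have hfin : IsFiniteMeasure (Λ.restrict (Icc 0 1)) :=
    ⟨by simpa using isCompact_Icc.measure_lt_top⟩
  have hnorm : ∀ v, ‖g v‖ ≤ C := fun v => by
    rw [Real.norm_eq_abs, abs_of_nonneg (hg0 v)]; exact hgC v
  have hint : ∀ (m : Measure ℝ) [IsFiniteMeasure m], Integrable g m := fun m _ =>
    Integrable.of_bound hgm.aestronglyMeasurable C (Eventually.of_forall hnorm)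
  have hints : ∀ v : ℝ, Integrable (fun r => g (v + r)) F := fun v =>
    Integrable.of_bound (hgm.comp (measurable_const_add v)).aestronglyMeasurable C
      (Eventually.of_forall fun r => hnorm _)
  set u : ℝ → ℝ := fun v => ∫ r, g (v + r) ∂F with hu
  have hu0 : ∀ v, 0 ≤ u v := fun v => integral_nonneg fun r => hg0 _
  have huC : ∀ v, u v ≤ C := fun v => by
    calc u v ≤ ∫ _, C ∂F := integral_mono (hints v) (integrable_const _) fun r => hgC _
      _ = C := by simp
  have hum : Measurable u := by
    have : StronglyMeasurable fun z : ℝ × ℝ => g (z.1 + z.2) :=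
      (hgm.comp measurable_add).stronglyMeasurable
    exact this.integral_prod_right.measurable
  have huc : ∀ v, ContinuousWithinAt u (Iic v) v := fun v => by
    refine continuousWithinAt_of_dominated (bound := fun _ => C)
      (Eventually.of_forall fun v => (hints v).aestronglyMeasurable)
      (Eventually.of_forall fun v => Eventually.of_forall fun r => hnorm _)
      (integrable_const _) (Eventually.of_forall fun r => ?_)
    refine ContinuousWithinAt.comp (t := Iic (v + r)) (f := fun x => x + r) (hgc (v + r))
      (by fun_prop) fun x hx => ?_
    simpa using hx
  have e : ∀ v, ∫⁻ r, ENNReal.ofReal (g (v + r)) ∂F = ENNReal.ofReal (u v) := fun v =>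
    (ofReal_integral_eq_lintegral_ofReal (hints v) (Eventually.of_forall fun r => hg0 _)).symm
  simp_rw [e]
  rw [h.lintegral_prod hu0 huC hum huc]
  congr 2
  rw [reportMeasure, integral_conv (f := fun w => g w - 1) ((hint _).sub (integrable_const 1)),
    ← integral_Icc_eq_integral_Ioc]
  refine integral_congr_ae (Eventually.of_forall fun v => ?_)
  simp only
  rw [integral_sub (hints v) (integrable_const 1)]
  simp [hu]

end IsPoissonArrivals

open Classical in
theorem integral_ite_mul_sub_one {ρ : Measure ℝ} [IsFiniteMeasure ρ] {ψ : ℝ → ℝ}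
    (hψ : Integrable ψ ρ) (t x z : ℝ) :
    ∫ w, ((if w ≤ t then z else 1) * (1 + x * ψ w) - 1) ∂ρ
      = (z - 1) * ρ.real (Iic t) + x * ((∫ w in Ioi t, ψ w ∂ρ) + z * ∫ w in Iic t, ψ w ∂ρ) := by
  have h1 : Integrable (fun w => (Iic t).indicator (fun w => (z - 1) + x * z * ψ w) w) ρ :=
    ((integrable_const _).add (hψ.const_mul _)).indicator measurableSet_Iic
  have h2 : Integrable (fun w => (Ioi t).indicator (fun w => x * ψ w) w) ρ :=
    (hψ.const_mul _).indicator measurableSet_Ioi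
  have e : ∀ w, (if w ≤ t then z else 1) * (1 + x * ψ w) - 1
      = (Iic t).indicator (fun w => (z - 1) + x * z * ψ w) w
        + (Ioi t).indicator (fun w => x * ψ w) w := fun w => by
    by_cases hw : w ≤ t
    · simp [hw, not_lt.2 hw]; ring
    · simp [hw, not_le.1 hw]
  simp_rw [e]
  rw [integral_add h1 h2, integral_indicator measurableSet_Iic, integral_indicator measurableSet_Ioi,
    integral_add (integrable_const _) (hψ.const_mul _).integrableOn, integral_const_mul,
    integral_const_mul, setIntegral_const, smul_eq_mul]
  ring

/-! ### Conditional moments given the marked count. -/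

section ConditionalMoments

variable {Ω : Type*} [MeasurableSpace Ω] {P : Measure Ω} {N : Ω → ℕ}
  {A : ℕ → Ω → Prop} {φ : ℕ → Ω → ℝ≥0∞} {a b₀ b₁ c₀ c₁ : ℝ}

theorem hasSum_exp_mul_expCoeff (a z : ℝ) (i : ℕ) :
    HasSum (fun l => Real.exp (-a) * expCoeff a i l * z ^ l) (Real.exp ((z - 1) * a) * z ^ i) := by
  have h := (hasSum_expCoeff a z i).mul_left (Real.exp (-a))
  rw [show Real.exp ((z - 1) * a) * z ^ i = Real.exp (-a) * (z ^ i * Real.exp (a * z)) by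
    rw [show (z - 1) * a = -a + a * z by ring, Real.exp_add]; ring]
  simpa only [mul_assoc] using h

open Classical in
-- The constant term in `x`: the marked count is Poisson with parameter `a`.
theorem measure_markedCount_eq (hN : Measurable N) (hA : ∀ k, MeasurableSet {ω | A k ω})
    (hφ : ∀ k, Measurable (φ k)) (hb₀ : 0 ≤ b₀) (hb₁ : 0 ≤ b₁)
    (H : ∀ x ∈ Icc (0 : ℝ) 1, ∀ z ∈ Icc (0 : ℝ) 1,
      ∫⁻ ω, ∏ k ∈ Finset.range (N ω), ((if A k ω then ENNReal.ofReal z else 1)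
          * (1 + ENNReal.ofReal x * φ k ω)) ∂P
        = ENNReal.ofReal (Real.exp ((z - 1) * a + x * (b₀ + z * b₁)))) (l : ℕ) :
    P {ω | markedCount N A ω = l} = ENNReal.ofReal (Real.exp (-a) * expCoeff a 0 l) := by
  rw [← setLIntegral_esymmSeq hN hA hφ hb₀ hb₁ H 0
    (d := fun l => Real.exp (-a) * expCoeff a 0 l) (fun z _ => ?_) l]
  · simp [esymmSeq_zero]
  · simpa using hasSum_exp_mul_expCoeff a z 0

open Classical in
theorem setLIntegral_sum_markedCount (hN : Measurable N) (hA : ∀ k, MeasurableSet {ω | A k ω})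
    (hφ : ∀ k, Measurable (φ k)) (hb₀ : 0 ≤ b₀) (hb₁ : 0 ≤ b₁)
    (H : ∀ x ∈ Icc (0 : ℝ) 1, ∀ z ∈ Icc (0 : ℝ) 1,
      ∫⁻ ω, ∏ k ∈ Finset.range (N ω), ((if A k ω then ENNReal.ofReal z else 1)
          * (1 + ENNReal.ofReal x * φ k ω)) ∂P
        = ENNReal.ofReal (Real.exp ((z - 1) * a + x * (b₀ + z * b₁)))) (l : ℕ) :
    ∫⁻ ω in {ω | markedCount N A ω = l}, ∑ k ∈ Finset.range (N ω), φ k ω ∂P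
      = ENNReal.ofReal (Real.exp (-a) * (b₀ * expCoeff a 0 l + b₁ * expCoeff a 1 l)) := by
  rw [← setLIntegral_esymmSeq hN hA hφ hb₀ hb₁ H 1
    (d := fun l => Real.exp (-a) * (b₀ * expCoeff a 0 l + b₁ * expCoeff a 1 l)) (fun z _ => ?_) l]
  · simp [esymmSeq_one]
  · have h := ((hasSum_exp_mul_expCoeff a z 0).mul_left b₀).add
      ((hasSum_exp_mul_expCoeff a z 1).mul_left b₁)
    rw [show Real.exp ((z - 1) * a) * ((b₀ + z * b₁) ^ 1 / (Nat.factorial 1 : ℕ))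
      = b₀ * (Real.exp ((z - 1) * a) * z ^ 0) + b₁ * (Real.exp ((z - 1) * a) * z ^ 1) by
        simp; ring]
    refine (funext fun l => ?_ : (fun l : ℕ => _) = _) ▸ h
    ring

open Classical in
theorem setLIntegral_esymmSeq_two (hN : Measurable N) (hA : ∀ k, MeasurableSet {ω | A k ω})
    (hφ : ∀ k, Measurable (φ k)) (hb₀ : 0 ≤ b₀) (hb₁ : 0 ≤ b₁)
    (H : ∀ x ∈ Icc (0 : ℝ) 1, ∀ z ∈ Icc (0 : ℝ) 1,
      ∫⁻ ω, ∏ k ∈ Finset.range (N ω), ((if A k ω then ENNReal.ofReal z else 1)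
          * (1 + ENNReal.ofReal x * φ k ω)) ∂P
        = ENNReal.ofReal (Real.exp ((z - 1) * a + x * (b₀ + z * b₁)))) (l : ℕ) :
    ∫⁻ ω in {ω | markedCount N A ω = l}, esymmSeq (fun k => φ k ω) (N ω) 2 ∂P
      = ENNReal.ofReal (Real.exp (-a) * (b₀ ^ 2 * expCoeff a 0 l + 2 * b₀ * b₁ * expCoeff a 1 l
          + b₁ ^ 2 * expCoeff a 2 l) / 2) := by
  rw [← setLIntegral_esymmSeq hN hA hφ hb₀ hb₁ H 2
    (d := fun l => Real.exp (-a) * (b₀ ^ 2 * expCoeff a 0 l + 2 * b₀ * b₁ * expCoeff a 1 l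
          + b₁ ^ 2 * expCoeff a 2 l) / 2) (fun z _ => ?_) l]
  have h := (((hasSum_exp_mul_expCoeff a z 0).mul_left (b₀ ^ 2 / 2)).add
    ((hasSum_exp_mul_expCoeff a z 1).mul_left (b₀ * b₁))).add
    ((hasSum_exp_mul_expCoeff a z 2).mul_left (b₁ ^ 2 / 2))
  rw [show Real.exp ((z - 1) * a) * ((b₀ + z * b₁) ^ 2 / (Nat.factorial 2 : ℕ))
    = b₀ ^ 2 / 2 * (Real.exp ((z - 1) * a) * z ^ 0) + b₀ * b₁ * (Real.exp ((z - 1) * a) * z ^ 1)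
      + b₁ ^ 2 / 2 * (Real.exp ((z - 1) * a) * z ^ 2) by
      simp [Nat.factorial]; ring]
  refine (funext fun l => ?_ : (fun l : ℕ => _) = _) ▸ h
  ring

open Classical in
-- This identifies the normalization `E[N̂(t)]` with the parameter `a` of the functional.
theorem integral_markedCount [IsProbabilityMeasure P] (hN : Measurable N) (hA : ∀ k, MeasurableSet {ω | A k ω})
    (hφ : ∀ k, Measurable (φ k)) (ha : 0 ≤ a) (hb₀ : 0 ≤ b₀) (hb₁ : 0 ≤ b₁)
    (H : ∀ x ∈ Icc (0 : ℝ) 1, ∀ z ∈ Icc (0 : ℝ) 1,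
      ∫⁻ ω, ∏ k ∈ Finset.range (N ω), ((if A k ω then ENNReal.ofReal z else 1)
          * (1 + ENNReal.ofReal x * φ k ω)) ∂P
        = ENNReal.ofReal (Real.exp ((z - 1) * a + x * (b₀ + z * b₁)))) :
    ∫ ω, (markedCount N A ω : ℝ) ∂P = a := by
  have hM : Measurable fun ω => (markedCount N A ω : ℝ) :=
    (measurable_of_countable fun n : ℕ => (n : ℝ)).comp (measurable_markedCount hN hA)
  have hpos : ∀ l, 0 ≤ expCoeff a 0 l := fun l => by unfold expCoeff; positivity
  have h0 : HasSum (fun l => Real.exp (-a) * expCoeff a 0 l) 1 := by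
    simpa using hasSum_exp_mul_expCoeff a 1 0
  have h1 : HasSum (fun l : ℕ => (l : ℝ) * (Real.exp (-a) * expCoeff a 0 l)) a := by
    have := (hasSum_exp_mul_expCoeff a 1 1).mul_left a
    simp only [sub_self, zero_mul, Real.exp_zero, one_pow, mul_one] at this
    refine (funext fun l => ?_ : (fun l : ℕ => _) = _) ▸ this
    linear_combination -Real.exp (-a) * mul_expCoeff_one a l
  rw [integral_eq_lintegral_of_nonneg_ae (Eventually.of_forall fun ω => by positivity)
    hM.aestronglyMeasurable,
    lintegral_comp_natValued hM h0 (fun l => ?_) ENNReal.ofReal]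
  · have : ∀ l : ℕ, ENNReal.ofReal (l : ℝ) * ENNReal.ofReal (Real.exp (-a) * expCoeff a 0 l)
        = ENNReal.ofReal ((l : ℝ) * (Real.exp (-a) * expCoeff a 0 l)) := fun l =>
      (ENNReal.ofReal_mul (by positivity)).symm
    simp_rw [this]
    rw [← ENNReal.ofReal_tsum_of_nonneg
      (fun l => mul_nonneg (by positivity) (mul_nonneg (Real.exp_pos _).le (hpos l))) h1.summable,
      h1.tsum_eq, ENNReal.toReal_ofReal ha]
  · simp only [Nat.cast_inj]
    rw [measureReal_def, measure_markedCount_eq hN hA hφ hb₀ hb₁ H,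
      ENNReal.toReal_ofReal (mul_nonneg (Real.exp_pos _).le (hpos l))]

open Classical in
/-- Conditional moments of the sum of the marks given the number of points of the first kind. -/
theorem cond_markedCount_moments [IsProbabilityMeasure P] (hN : Measurable N) (hA : ∀ k, MeasurableSet {ω | A k ω})
    (hφ : ∀ k, Measurable (φ k)) (ha : 0 ≤ a) (hb₀ : 0 ≤ b₀) (hb₁ : 0 ≤ b₁) (hc₀ : 0 ≤ c₀)
    (hc₁ : 0 ≤ c₁)
    (H : ∀ x ∈ Icc (0 : ℝ) 1, ∀ z ∈ Icc (0 : ℝ) 1,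
      ∫⁻ ω, ∏ k ∈ Finset.range (N ω), ((if A k ω then ENNReal.ofReal z else 1)
          * (1 + ENNReal.ofReal x * φ k ω)) ∂P
        = ENNReal.ofReal (Real.exp ((z - 1) * a + x * (b₀ + z * b₁))))
    (H' : ∀ x ∈ Icc (0 : ℝ) 1, ∀ z ∈ Icc (0 : ℝ) 1,
      ∫⁻ ω, ∏ k ∈ Finset.range (N ω), ((if A k ω then ENNReal.ofReal z else 1)
          * (1 + ENNReal.ofReal x * φ k ω ^ 2)) ∂P
        = ENNReal.ofReal (Real.exp ((z - 1) * a + x * (c₀ + z * c₁))))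
    {l : ℕ} (hl : P {ω | markedCount N A ω = l} ≠ 0) {X : Ω → ℝ}
    (hX : X =ᵐ[P] fun ω => (∑ k ∈ Finset.range (N ω), φ k ω).toReal) :
    MemLp X 2 (cond P {ω | markedCount N A ω = l}) ∧
    ∫ ω, X ω ∂(cond P {ω | markedCount N A ω = l}) = b₀ + l * (b₁ / a) ∧
    variance X (cond P {ω | markedCount N A ω = l}) = c₀ + l * (c₁ / a) - l * (b₁ / a) ^ 2 := by
  set E : Set Ω := {ω | markedCount N A ω = l}
  set Q := cond P E with hQ
  have hQprob : IsProbabilityMeasure Q := cond_isProbabilityMeasure hl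
  set S : Ω → ℝ≥0∞ := fun ω => ∑ k ∈ Finset.range (N ω), φ k ω with hS
  have hSm : Measurable S := Measurable.apply_nat
    (f := fun n ω => ∑ k ∈ Finset.range n, φ k ω)
    (fun n => Finset.measurable_fun_sum _ fun k _ => hφ k) hN
  have hPE : P E = ENNReal.ofReal (Real.exp (-a) * expCoeff a 0 l) :=
    measure_markedCount_eq hN hA hφ hb₀ hb₁ H l
  have hq : 0 < expCoeff a 0 l := by
    by_contra hneg
    apply hl
    rw [hPE, ENNReal.ofReal_eq_zero]
    exact mul_nonpos_of_nonneg_of_nonpos (Real.exp_pos _).le (not_lt.1 hneg)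
  have he : ∀ i, 0 ≤ expCoeff a i l := fun i => by unfold expCoeff; positivity
  have hcond : ∀ f : Ω → ℝ≥0∞, ∀ m : ℝ, 0 ≤ m →
      ∫⁻ ω in E, f ω ∂P = ENNReal.ofReal (Real.exp (-a) * m) →
      ∫⁻ ω, f ω ∂Q = ENNReal.ofReal (m / expCoeff a 0 l) := by
    intro f m hm hf
    rw [hQ, ProbabilityTheory.cond, lintegral_smul_measure, hf, hPE, smul_eq_mul,
      ← ENNReal.ofReal_inv_of_pos (by positivity), ← ENNReal.ofReal_mul (by positivity)]
    congr 1
    have := Real.exp_pos (-a)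
    field_simp
  have h1 := hcond S _ (by have := he 1; positivity)
    (setLIntegral_sum_markedCount hN hA hφ hb₀ hb₁ H l)
  have h2 : ∫⁻ ω, S ω ^ 2 ∂Q = ENNReal.ofReal ((c₀ * expCoeff a 0 l + c₁ * expCoeff a 1 l
      + (b₀ ^ 2 * expCoeff a 0 l + 2 * b₀ * b₁ * expCoeff a 1 l + b₁ ^ 2 * expCoeff a 2 l))
      / expCoeff a 0 l) := by
    have := he 1
    have := he 2
    refine hcond (fun ω => S ω ^ 2) _ (by positivity) ?_
    -- The diagonal part is linear in the squared marks and is governed by `H'`; the off-diagonal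
    -- part is the second coefficient of `H`.
    have hsq : ∀ ω, S ω ^ 2 = ∑ k ∈ Finset.range (N ω), φ k ω ^ 2
        + 2 * esymmSeq (fun k => φ k ω) (N ω) 2 := fun ω => sq_sum_eq_esymmSeq _ _
    have hm2 : Measurable fun ω => ∑ k ∈ Finset.range (N ω), φ k ω ^ 2 := Measurable.apply_nat
      (f := fun n ω => ∑ k ∈ Finset.range n, φ k ω ^ 2)
      (fun n => Finset.measurable_fun_sum _ fun k _ => (hφ k).pow_const 2) hN
    have hm3 : Measurable fun ω => esymmSeq (fun k => φ k ω) (N ω) 2 :=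
      Measurable.apply_nat (f := fun n ω => esymmSeq (fun k => φ k ω) n 2)
        (fun n => measurable_esymmSeq hφ n 2) hN
    simp_rw [hsq]
    rw [lintegral_add_left hm2, lintegral_const_mul _ hm3,
      setLIntegral_sum_markedCount hN hA (fun k => (hφ k).pow_const 2) hc₀ hc₁ H' l,
      setLIntegral_esymmSeq_two hN hA hφ hb₀ hb₁ H l, ← ENNReal.ofReal_ofNat 2,
      ← ENNReal.ofReal_mul (by norm_num), ← ENNReal.ofReal_add (by positivity) (by positivity)]
    congr 1
    ring
  have hXQ : X =ᵐ[Q] fun ω => (S ω).toReal := cond_absolutelyContinuous.ae_eq hX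
  have hSfin : ∀ᵐ ω ∂Q, S ω < ∞ := ae_lt_top hSm (by simp [h1])
  have hS2fin : ∀ᵐ ω ∂Q, S ω ^ 2 < ∞ := ae_lt_top (hSm.pow_const 2) (by simp [h2])
  have hmem : MemLp (fun ω => (S ω).toReal) 2 Q := by
    rw [memLp_two_iff_integrable_sq hSm.ennreal_toReal.aestronglyMeasurable]
    have := integrable_toReal_of_lintegral_ne_top (μ := Q) (hSm.pow_const 2).aemeasurable
      (by rw [h2]; exact ENNReal.ofReal_ne_top)
    simpa [ENNReal.toReal_pow] using this
  have hr1 : a ≠ 0 → expCoeff a 1 l / expCoeff a 0 l = l / a := fun ha0 => by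
    rw [div_eq_div_iff hq.ne' ha0]; linarith [mul_expCoeff_one a l]
  have hr2 : a ≠ 0 → expCoeff a 2 l / expCoeff a 0 l = l * (l - 1) / a ^ 2 := fun ha0 => by
    rw [div_eq_div_iff hq.ne' (pow_ne_zero 2 ha0)]; linarith [sq_mul_expCoeff_two a l]
  -- If `a = 0`, only `l = 0` has positive probability, so the quotients by `a` carry a zero factor.
  have hl0 : a = 0 → l = 0 := fun ha0 => by
    have : (l : ℝ) * expCoeff a 0 l = 0 := by rw [← mul_expCoeff_one, ha0, zero_mul]
    exact_mod_cast (mul_eq_zero.1 this).resolve_right hq.ne'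
  have hmean : ∫ ω, X ω ∂Q = b₀ + l * (b₁ / a) := by
    have := he 1
    rw [integral_congr_ae hXQ, integral_toReal hSm.aemeasurable hSfin, h1,
      ENNReal.toReal_ofReal (by positivity), add_div, mul_div_assoc, div_self hq.ne', mul_div_assoc]
    by_cases ha0 : a = 0
    · simp [hl0 ha0, expCoeff]
    · rw [hr1 ha0]; ring
  refine ⟨(memLp_congr_ae hXQ).2 hmem, hmean, ?_⟩
  rw [variance_congr hXQ, variance_eq_sub hmem, ← integral_congr_ae hXQ, hmean]
  have hsq : ∫ ω, ((fun ω => (S ω).toReal) ^ 2) ω ∂Q = ∫ ω, (S ω ^ 2).toReal ∂Q := by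
    simp [ENNReal.toReal_pow]
  have := he 1
  have := he 2
  rw [hsq, integral_toReal (hSm.pow_const 2).aemeasurable hS2fin, h2,
    ENNReal.toReal_ofReal (by positivity)]
  have hexp : (c₀ * expCoeff a 0 l + c₁ * expCoeff a 1 l
      + (b₀ ^ 2 * expCoeff a 0 l + 2 * b₀ * b₁ * expCoeff a 1 l + b₁ ^ 2 * expCoeff a 2 l))
      / expCoeff a 0 l = c₀ + c₁ * (expCoeff a 1 l / expCoeff a 0 l)
      + (b₀ ^ 2 + 2 * b₀ * b₁ * (expCoeff a 1 l / expCoeff a 0 l)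
        + b₁ ^ 2 * (expCoeff a 2 l / expCoeff a 0 l)) := by
    field_simp
  rw [hexp]
  by_cases ha0 : a = 0
  · simp [hl0 ha0, expCoeff]
  · rw [hr1 ha0, hr2 ha0]
    field_simp
    ring

end ConditionalMoments

/-! ### The delayed cluster model. -/

/-- The number of claims that a cluster with path `z.2.2`, arrival time `z.1` and reporting delay
`z.2.1` contributes to the period `(t, t + s]`. -/
noncomputable def clusterIncrement (t s : ℝ) (z : ℝ≥0∞ × ℝ × (ℝ → ℝ)) : ℝ≥0∞ :=
  ENNReal.ofReal (rightEval z.2.2 (t + s - (z.1.toReal + z.2.1))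
    - rightEval z.2.2 (t - (z.1.toReal + z.2.1)))

theorem measurable_clusterIncrement (t s : ℝ) : Measurable (clusterIncrement t s) := by
  have hR : Measurable fun z : ℝ≥0∞ × ℝ × (ℝ → ℝ) => z.1.toReal + z.2.1 :=
    measurable_fst.ennreal_toReal.add measurable_snd.fst
  have hf : Measurable fun z : ℝ≥0∞ × ℝ × (ℝ → ℝ) => z.2.2 := measurable_snd.snd
  exact ENNReal.measurable_ofReal.comp
    ((measurable_rightEval_comp hf (hR.const_sub _)).sub (measurable_rightEval_comp hf (hR.const_sub _)))

namespace IsDelayedNBClusterModel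

variable {Ω : Type*} [MeasurableSpace Ω] {P : Measure Ω}
  {T : ℕ → Ω → ℝ≥0∞} {D : ℕ → Ω → ℝ} {L : ℕ → ℝ → Ω → ℝ} {Λ F_D : Measure ℝ}
  {μ : ℝ → ℝ} {p t s : ℝ}

theorem isProbabilityMeasure_delay [IsProbabilityMeasure P] (h : IsDelayedNBClusterModel T D L Λ F_D μ p P) :
    IsProbabilityMeasure F_D := by
  rw [← h.delay_law 0]
  exact Measure.isProbabilityMeasure_map (h.delay_measurable 0).aemeasurable

theorem ae_delay_nonneg (h : IsDelayedNBClusterModel T D L Λ F_D μ p P) :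
    ∀ᵐ r ∂F_D, 0 ≤ r := by
  rw [← h.delay_law 0, ae_map_iff (h.delay_measurable 0).aemeasurable measurableSet_Ici]
  exact h.delay_nonneg 0

theorem measurable_path (h : IsDelayedNBClusterModel T D L Λ F_D μ p P) (k : ℕ) :
    Measurable fun ω (y : ℝ) => L k y ω :=
  measurable_pi_lambda _ (h.cluster k).measurable

theorem measurable_clusterIncrement_comp (h : IsDelayedNBClusterModel T D L Λ F_D μ p P)
    (t s : ℝ) (k : ℕ) :
    Measurable fun ω => clusterIncrement t s (T k ω, D k ω, fun y => L k y ω) :=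
  (measurable_clusterIncrement t s).comp
    ((h.arrivals.measurable k).prodMk ((h.delay_measurable k).prodMk (h.measurable_path k)))

theorem lintegral_clusterIncrement_pow [IsProbabilityMeasure P] (h : IsDelayedNBClusterModel T D L Λ F_D μ p P)
    (hμ : Monotone μ) (hp0 : 0 < p) (hp1 : p < 1) (hs : 0 ≤ s) {j : ℕ} {ψ : ℝ → ℝ}
    (hψ : ∀ r, HasSum (fun k : ℕ => (k : ℝ) ^ j * negBinomialPMF r p k) (ψ r))
    (k : ℕ) (τ : ℝ≥0∞) (r : ℝ) :
    ∫⁻ ω, clusterIncrement t s (τ, r, fun y => L k y ω) ^ j ∂P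
      = ENNReal.ofReal (ψ (μ (t + s - (τ.toReal + r)) - μ (t - (τ.toReal + r)))) := by
  rw [← (h.cluster k).lintegral_ofReal_increment_pow hμ hp0 hp1
    (show t - (τ.toReal + r) ≤ t + s - (τ.toReal + r) by linarith) (hψ _)]
  refine lintegral_congr_ae ?_
  filter_upwards [(h.cluster k).cadlag] with ω hω
  simp only [clusterIncrement]
  rw [rightEval_eq (hω _).1, rightEval_eq (hω _).1]

open Classical in
/-- The probability generating functional of the cluster increments, with the reported clusters
marked by `z`. -/
theorem lintegral_prod_clusterIncrement [IsProbabilityMeasure P] [IsLocallyFiniteMeasure Λ] [NullSingletonClass Λ]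
    (h : IsDelayedNBClusterModel T D L Λ F_D μ p P)
    (hμ : IsMeanValueFunction μ) (hp0 : 0 < p) (hp1 : p < 1) (hs : 0 ≤ s) {j : ℕ}
    {ψ : ℝ → ℝ} (hψc : Continuous ψ) (hψ0 : ∀ r, 0 ≤ r → 0 ≤ ψ r)
    (hψ : ∀ r, HasSum (fun k : ℕ => (k : ℝ) ^ j * negBinomialPMF r p k) (ψ r))
    {x z : ℝ} (hx : x ∈ Icc (0 : ℝ) 1) (hz : z ∈ Icc (0 : ℝ) 1) :
    ∫⁻ ω, ∏ k ∈ Finset.range (arrivalCount T 1 ω),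
        ((if (T k ω).toReal + D k ω ≤ t then ENNReal.ofReal z else 1)
          * (1 + ENNReal.ofReal x * clusterIncrement t s (T k ω, D k ω, fun y => L k y ω) ^ j)) ∂P
      = ENNReal.ofReal (Real.exp ((z - 1) * (reportMeasure Λ F_D).real (Iic t)
        + x * ((∫ w in Ioi t, ψ (μ (t + s - max w 0) - μ (t - max w 0)) ∂(reportMeasure Λ F_D))
          + z * ∫ w in Iic t, ψ (μ (t + s - max w 0) - μ (t - max w 0))
              ∂(reportMeasure Λ F_D)))) := by
  have := h.isProbabilityMeasure_delay
  have hfin : IsFiniteMeasure (Λ.restrict (Icc 0 1)) :=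
    ⟨by simpa using isCompact_Icc.measure_lt_top⟩
  have hfinρ : IsFiniteMeasure (reportMeasure Λ F_D) := by unfold reportMeasure; infer_instance
  have hinc : ∀ w, 0 ≤ μ (t + s - w) - μ (t - w) := fun w =>
    sub_nonneg.2 (hμ.monotone (by linarith))
  set κ : ℝ → ℝ := fun w => ψ (μ (t + s - w) - μ (t - w)) with hκ
  have hμc := hμ.continuous
  have hκc : Continuous κ := by fun_prop
  have hκ0 : ∀ w, 0 ≤ κ w := fun w => hψ0 _ (hinc w)
  -- `κ` may be unbounded at negative `w`. Freezing it there gives the global bound that the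
  -- functional requires and changes nothing at the nonnegative reporting times.
  set κ' : ℝ → ℝ := fun w => κ (max w 0) with hκ'
  have hκ'c : Continuous κ' := by fun_prop
  obtain ⟨K, hK⟩ : ∃ K, ∀ w, κ' w ≤ K := by
    obtain ⟨K, hK⟩ := (isCompact_Icc (a := (0 : ℝ)) (b := μ (t + s))).exists_bound_of_continuousOn
      hψc.continuousOn
    refine ⟨K, fun w => (le_abs_self _).trans (hK _ ⟨hinc _, ?_⟩)⟩
    have h1 : μ (t + s - max w 0) ≤ μ (t + s) := hμ.monotone (by linarith [le_max_right w 0])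
    have h2 : 0 ≤ μ (t - max w 0) := by
      rcases le_or_gt (t - max w 0) 0 with h | h
      · exact (hμ.eq_zero _ h).ge
      · exact (hμ.pos _ h).le
    linarith
  set G : (ℝ → ℝ) → ℝ → ℝ := fun κ w => (if w ≤ t then z else 1) * (1 + x * κ w) with hG
  have hite0 : ∀ w, 0 ≤ (if w ≤ t then z else 1 : ℝ) := fun w => by
    split_ifs
    exacts [hz.1, zero_le_one]
  have hite1 : ∀ w, (if w ≤ t then z else 1 : ℝ) ≤ 1 := fun w => by
    split_ifs
    exacts [hz.2, le_rfl]
  have hGm : ∀ κ : ℝ → ℝ, Continuous κ → Measurable (G κ) := fun κ hκ =>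
    (Measurable.ite measurableSet_Iic measurable_const measurable_const).mul
      ((hκ.measurable.const_mul x).const_add 1)
  have hG0 : ∀ w, 0 ≤ G κ' w := fun w =>
    mul_nonneg (hite0 w) (add_nonneg zero_le_one (mul_nonneg hx.1 (hκ0 _)))
  have hGC : ∀ w, G κ' w ≤ 1 + K := fun w => by
    have h1 : x * κ' w ≤ K := (mul_le_of_le_one_left (hκ0 _) hx.2).trans (hK w)
    have h2 : 0 ≤ x * κ' w := mul_nonneg hx.1 (hκ0 _)
    calc G κ' w ≤ 1 * (1 + x * κ' w) := mul_le_mul_of_nonneg_right (hite1 w) (by linarith)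
      _ ≤ 1 + K := by linarith
  -- The marking factor jumps at `t`, but it is left-continuous because the reported side `w ≤ t` is
  -- closed.
  have hGcont : ∀ w, ContinuousWithinAt (G κ') (Iic w) w := fun w => by
    refine ContinuousWithinAt.mul ?_ (by fun_prop)
    by_cases hw : w ≤ t
    · refine (continuousWithinAt_const (b := z)).congr (fun y hy => ?_) ?_
      · simp [le_trans hy hw]
      · simp [hw]
    · have hev : (fun y => if y ≤ t then z else 1 : ℝ → ℝ) =ᶠ[𝓝 w] fun _ => 1 := by
        filter_upwards [lt_mem_nhds (not_le.1 hw)] with y hy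
        simp [not_le.2 hy]
      exact (continuousAt_const.congr hev.symm).continuousWithinAt
  have hN : Measurable fun τ : ℕ → ℝ≥0∞ => {k : ℕ | τ k ≤ ((1 : ℝ≥0) : ℝ≥0∞)}.ncard :=
    measurable_ncard_setOf fun k => measurableSet_le (measurable_pi_apply k) measurable_const
  have hR : Measurable fun a : ℝ≥0∞ × ℝ => a.1.toReal + a.2 := by fun_prop
  have hR' : Measurable fun a : ℝ≥0∞ × ℝ × (ℝ → ℝ) => a.1.toReal + a.2.1 := by fun_prop
  have hmarks := lintegral_prod_marks (P := P) (T := T) (D := D) (L := fun k ω y => L k y ω)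
    h.arrivals.measurable h.delay_measurable h.measurable_path h.delay_iIndep h.cluster_iIndep
    h.indep_arrivals_clusters h.indep_delays h.delay_law hN
    (h := fun a => (if a.1.toReal + a.2.1 ≤ t then ENNReal.ofReal z else 1)
      * (1 + ENNReal.ofReal x * clusterIncrement t s a ^ j))
    ((Measurable.ite (measurableSet_le hR' measurable_const) measurable_const
      measurable_const).mul ((((measurable_clusterIncrement t s).pow_const j).const_mul _).const_add 1))
    (g := fun a => ENNReal.ofReal (G κ (a.1.toReal + a.2)))
    (ENNReal.measurable_ofReal.comp ((hGm κ hκc).comp hR))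
    (fun k τ r => by
      have hm : Measurable fun ω => clusterIncrement t s (τ, r, fun y => L k y ω) ^ j :=
        ((measurable_clusterIncrement t s).comp (measurable_const.prodMk
          (measurable_const.prodMk (h.measurable_path k)))).pow_const j
      have hm' : Measurable fun ω => 1 + ENNReal.ofReal x
          * clusterIncrement t s (τ, r, fun y => L k y ω) ^ j := (hm.const_mul _).const_add 1
      change ∫⁻ ω, (if τ.toReal + r ≤ t then ENNReal.ofReal z else 1) * (1 + ENNReal.ofReal x
        * clusterIncrement t s (τ, r, fun y => L k y ω) ^ j) ∂P = _
      rw [lintegral_const_mul _ hm', lintegral_add_left measurable_const, lintegral_const_mul _ hm,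
        h.lintegral_clusterIncrement_pow hμ.monotone hp0 hp1 hs hψ, lintegral_const, measure_univ,
        mul_one, hG, ENNReal.ofReal_mul (hite0 _),
        ENNReal.ofReal_add zero_le_one (mul_nonneg hx.1 (hκ0 _)), ENNReal.ofReal_mul hx.1,
        ENNReal.ofReal_one]
      congr 1
      split_ifs <;> simp)
  refine hmarks.trans ?_
  have hconv := h.arrivals.lintegral_prod_conv (F := F_D) hG0 hGC (hGm κ' hκ'c) hGcont
  rw [integral_ite_mul_sub_one (Integrable.of_bound hκ'c.aestronglyMeasurable K
    (Eventually.of_forall fun w => by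
      rw [Real.norm_eq_abs, abs_of_nonneg (hκ0 _)]; exact hK w)) t x z] at hconv
  refine Eq.trans ?_ hconv
  refine lintegral_congr fun ω => Finset.prod_congr rfl fun k _ => lintegral_congr_ae ?_
  filter_upwards [h.ae_delay_nonneg] with r hr
  simp only [hG, hκ']
  rw [max_eq_left (add_nonneg ENNReal.toReal_nonneg hr)]

theorem reportedCount_ae_eq (h : IsDelayedNBClusterModel T D L Λ F_D μ p P) (t : ℝ) :
    reportedCount T D t =ᵐ[P]
      markedCount (arrivalCount T 1) fun k ω => (T k ω).toReal + D k ω ≤ t := by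
  classical
  filter_upwards [h.arrivals.le_iff_lt_arrivalCount] with ω hω
  have hω1 : ∀ k, T k ω ≤ 1 ↔ k < arrivalCount T 1 ω := fun k => by simpa using hω 1 k
  rw [reportedCount, markedCount, ← Finset.card_filter, ← Set.ncard_coe_finset]
  congr 1
  ext k
  simp [hω1]

/-- Almost surely the series is a finite sum over the arrivals in `(0, 1]`. Monotone
right-continuous paths ensure that neither `ENNReal.ofReal` nor `rightEval` alters the increments.
-/
theorem delayedIncrement_ae_eq [IsProbabilityMeasure P] (h : IsDelayedNBClusterModel T D L Λ F_D μ p P)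
    (hp0 : 0 < p) (hp1 : p < 1) (hs : 0 ≤ s) :
    delayedIncrement T D L t s =ᵐ[P] fun ω => (∑ k ∈ Finset.range (arrivalCount T 1 ω),
      clusterIncrement t s (T k ω, D k ω, fun y => L k y ω)).toReal := by
  classical
  have hmono : ∀ᵐ ω ∂P, ∀ k, Monotone fun y => L k y ω :=
    ae_all_iff.2 fun k => (h.cluster k).ae_monotone hp0 hp1
  have hcad : ∀ᵐ ω ∂P, ∀ k, ∀ y : ℝ, ContinuousWithinAt (fun r => L k r ω) (Ici y) y :=
    ae_all_iff.2 fun k => (h.cluster k).cadlag.mono fun ω hω y => (hω y).1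
  filter_upwards [h.arrivals.le_iff_lt_arrivalCount, hmono, hcad] with ω hω hm hc
  have hω1 : ∀ k, T k ω ≤ 1 ↔ k < arrivalCount T 1 ω := fun k => by simpa using hω 1 k
  have htot : ∀ y, delayedTotal T D L y ω = ∑ k ∈ Finset.range (arrivalCount T 1 ω),
      L k (y - ((T k ω).toReal + D k ω)) ω := fun y => by
    rw [delayedTotal, tsum_eq_sum (s := Finset.range (arrivalCount T 1 ω))]
    · exact Finset.sum_congr rfl fun k hk => if_pos ((hω1 k).2 (Finset.mem_range.1 hk))
    · intro k hk
      exact if_neg (mt (hω1 k).1 (by simpa using hk))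
  rw [delayedIncrement, htot, htot, ← Finset.sum_sub_distrib, ENNReal.toReal_sum fun k _ => by
    simp [clusterIncrement]]
  refine Finset.sum_congr rfl fun k _ => ?_
  rw [clusterIncrement]
  simp only
  rw [rightEval_eq (hc k _), rightEval_eq (hc k _), ENNReal.toReal_ofReal]
  exact sub_nonneg.2 (hm k (by linarith))

theorem reportMeasure_Iio_zero [IsProbabilityMeasure P] [IsLocallyFiniteMeasure Λ]
    (h : IsDelayedNBClusterModel T D L Λ F_D μ p P) :
    reportMeasure Λ F_D (Iio 0) = 0 := by
  have := h.isProbabilityMeasure_delay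
  rw [← lintegral_indicator_one measurableSet_Iio, reportMeasure,
    Measure.lintegral_conv (measurable_one.indicator measurableSet_Iio)]
  rw [lintegral_eq_zero_of_ae_eq_zero]
  filter_upwards [ae_restrict_mem measurableSet_Icc] with v hv
  refine lintegral_eq_zero_of_ae_eq_zero ?_
  filter_upwards [h.ae_delay_nonneg] with r hr
  simp [add_nonneg hv.1 hr]

theorem setIntegral_Iic_eq [IsProbabilityMeasure P] [IsLocallyFiniteMeasure Λ]
    (h : IsDelayedNBClusterModel T D L Λ F_D μ p P) (f : ℝ → ℝ) :
    ∫ w in Iic t, f (max w 0) ∂(reportMeasure Λ F_D) = ∫ w in Icc 0 t, f w ∂(reportMeasure Λ F_D) := by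
  have hae : (Icc 0 t : Set ℝ) =ᵐ[reportMeasure Λ F_D] Iic t := by
    have h0 : ∀ᵐ w ∂(reportMeasure Λ F_D), 0 ≤ w := by
      rw [ae_iff]; simpa [Set.Iio_def] using h.reportMeasure_Iio_zero
    filter_upwards [h0] with w hw
    exact propext (and_iff_right hw)
  rw [← setIntegral_congr_set hae]
  exact setIntegral_congr_fun measurableSet_Icc fun w hw => by simp [max_eq_left hw.1]

/-- For `w > t` the cluster is empty at time `t`, and for `w > t + s` also at `t + s`. What remains
lives on `(t, t + s]`, and unfolding the convolution with `w = v + r` gives the double integral. -/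
theorem setIntegral_Ioi_eq [IsProbabilityMeasure P] [IsLocallyFiniteMeasure Λ]
    (h : IsDelayedNBClusterModel T D L Λ F_D μ p P) (hμ : IsMeanValueFunction μ) (ht : 0 ≤ t)
    {ψ : ℝ → ℝ} (hψc : Continuous ψ) (hψ0 : ψ 0 = 0) :
    ∫ w in Ioi t, ψ (μ (t + s - max w 0) - μ (t - max w 0)) ∂(reportMeasure Λ F_D)
      = ∫ v in Icc (0 : ℝ) 1,
          (∫ r in Ioc (t - v) (t + s - v), ψ (μ (t + s - v - r)) ∂F_D) ∂Λ := by
  have := h.isProbabilityMeasure_delay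
  have hfin : IsFiniteMeasure (Λ.restrict (Icc 0 1)) :=
    ⟨by simpa using isCompact_Icc.measure_lt_top⟩
  have hfinρ : IsFiniteMeasure (reportMeasure Λ F_D) := by unfold reportMeasure; infer_instance
  have hμc := hμ.continuous
  have hset : ∀ w ∈ Ioi t, ψ (μ (t + s - max w 0) - μ (t - max w 0))
      = (Iic (t + s)).indicator (fun w => ψ (μ (t + s - w))) w := by
    intro w hw
    rw [max_eq_left (ht.trans (le_of_lt hw)), hμ.eq_zero (t - w) (by linarith [mem_Ioi.1 hw]),
      sub_zero]
    by_cases hws : w ≤ t + s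
    · simp [hws]
    · rw [indicator_of_notMem (by simpa using hws), hμ.eq_zero _ (by linarith), hψ0]
  rw [setIntegral_congr_fun measurableSet_Ioi hset, setIntegral_indicator measurableSet_Iic,
    Ioi_inter_Iic, ← integral_indicator measurableSet_Ioc, reportMeasure, integral_conv]
  · refine integral_congr_ae (Eventually.of_forall fun v => ?_)
    simp only
    rw [← integral_indicator measurableSet_Ioc]
    refine integral_congr_ae (Eventually.of_forall fun r => ?_)
    simp only [indicator, mem_Ioc]
    congr 1
    · exact propext ⟨fun h => ⟨by linarith [h.1], by linarith [h.2]⟩,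
        fun h => ⟨by linarith [h.1], by linarith [h.2]⟩⟩
    · rw [sub_sub (t + s)]
  · change Integrable _ (reportMeasure Λ F_D)
    rw [integrable_indicator_iff measurableSet_Ioc]
    exact ((by fun_prop : Continuous fun w => ψ (μ (t + s - w))).continuousOn.integrableOn_compact
      isCompact_Icc).mono_set Ioc_subset_Icc_self

end IsDelayedNBClusterModel

/-! ### Assembly of the conditional mean and variance. -/

theorem lemma3p5 {Ω : Type*} [MeasurableSpace Ω] (P : Measure Ω) [IsProbabilityMeasure P]
    (T : ℕ → Ω → ℝ≥0∞) (D : ℕ → Ω → ℝ) (L : ℕ → ℝ → Ω → ℝ)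
    (Λ : Measure ℝ) [IsLocallyFiniteMeasure Λ] (hΛ : ∀ x, Λ {x} = 0) (F_D : Measure ℝ)
    (μ : ℝ → ℝ) (hμ : IsMeanValueFunction μ) (p : ℝ) (hp0 : 0 < p) (hp1 : p < 1)
    (hmodel : IsDelayedNBClusterModel T D L Λ F_D μ p P)
    (t s : ℝ) (ht : 1 ≤ t) (hs : 0 < s) (ℓ : ℕ)
    (hℓ : P {ω | reportedCount T D t ω = ℓ} ≠ 0) :
    MemLp (delayedIncrement T D L t s) 2 (condReported T D t ℓ P) ∧
    (∫ ω, delayedIncrement T D L t s ω ∂(condReported T D t ℓ P)) =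
      ℓ * ((1 - p) / p) *
          (∫ u in Icc 0 t, (μ (t + s - u) - μ (t - u)) / meanReported T D t P
            ∂(reportMeasure Λ F_D))
        + ((1 - p) / p) *
          (∫ v in Icc (0 : ℝ) 1, (∫ r in Ioc (t - v) (t + s - v), μ (t + s - v - r) ∂F_D) ∂Λ) ∧
    variance (delayedIncrement T D L t s) (condReported T D t ℓ P) =
      (∫ ω, delayedIncrement T D L t s ω ∂(condReported T D t ℓ P)) / p
        + ℓ * ((1 - p) ^ 2 / p ^ 2) *
          (∫ u in Icc 0 t, (μ (t + s - u) - μ (t - u)) ^ 2 / meanReported T D t P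
            ∂(reportMeasure Λ F_D))
        - ℓ * ((1 - p) ^ 2 / p ^ 2) *
          (∫ u in Icc 0 t, (μ (t + s - u) - μ (t - u)) / meanReported T D t P
            ∂(reportMeasure Λ F_D)) ^ 2
        + ((1 - p) ^ 2 / p ^ 2) *
          (∫ v in Icc (0 : ℝ) 1,
            (∫ r in Ioc (t - v) (t + s - v), μ (t + s - v - r) ^ 2 ∂F_D) ∂Λ) := by
  classical
  have hΛ' : NullSingletonClass Λ := ⟨hΛ⟩
  have hFD := hmodel.isProbabilityMeasure_delay
  have hfin : IsFiniteMeasure (Λ.restrict (Icc 0 1)) :=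
    ⟨by simpa using isCompact_Icc.measure_lt_top⟩
  have hfinρ : IsFiniteMeasure (reportMeasure Λ F_D) := by unfold reportMeasure; infer_instance
  have hμc := hμ.continuous
  have hq : 0 ≤ 1 - p := by linarith
  have ht0 : 0 ≤ t := by linarith
  have hinc : ∀ w, 0 ≤ μ (t + s - w) - μ (t - w) := fun w =>
    sub_nonneg.2 (hμ.monotone (by linarith))
  -- `ψ₁ r` and `ψ₂ r` are the first two moments of `NB(r, p)`. The linear part of `ψ₂` is `ψ₁ / p`,
  -- the source of the term mean over `p` in the variance.
  set ψ₁ : ℝ → ℝ := fun r => r * ((1 - p) / p) with hψ₁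
  set ψ₂ : ℝ → ℝ := fun r => r * ((1 - p) / p ^ 2) + r ^ 2 * ((1 - p) ^ 2 / p ^ 2) with hψ₂
  have hc₁ : Continuous ψ₁ := by fun_prop
  have hc₂ : Continuous ψ₂ := by fun_prop
  have hn₁ : ∀ r, 0 ≤ r → 0 ≤ ψ₁ r := fun r hr => by positivity
  have hn₂ : ∀ r, 0 ≤ r → 0 ≤ ψ₂ r := fun r hr => by positivity
  have hs₁ : ∀ r, HasSum (fun k : ℕ => (k : ℝ) ^ 1 * negBinomialPMF r p k) (ψ₁ r) := fun r => by
    simpa using hasSum_mul_negBinomialPMF r hp0 hp1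
  have hs₂ : ∀ r, HasSum (fun k : ℕ => (k : ℝ) ^ 2 * negBinomialPMF r p k) (ψ₂ r) := fun r =>
    hasSum_sq_mul_negBinomialPMF r hp0 hp1
  have hN := hmodel.arrivals.measurable_arrivalCount 1
  have hA : ∀ k, MeasurableSet {ω | (T k ω).toReal + D k ω ≤ t} := fun k =>
    measurableSet_le ((hmodel.arrivals.measurable k).ennreal_toReal.add
      (hmodel.delay_measurable k)) measurable_const
  have hφ := hmodel.measurable_clusterIncrement_comp t s
  have hcount := hmodel.reportedCount_ae_eq t
  have hset : ({ω | reportedCount T D t ω = ℓ} : Set Ω) =ᵐ[P]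
      {ω | markedCount (arrivalCount T 1) (fun k ω => (T k ω).toReal + D k ω ≤ t) ω = ℓ} := by
    refine Filter.eventuallyEq_set.2 ?_
    filter_upwards [hcount] with ω hω
    rw [hω]
  have hcondeq : condReported T D t ℓ P = ProbabilityTheory.cond P
      {ω | markedCount (arrivalCount T 1) (fun k ω => (T k ω).toReal + D k ω ≤ t) ω = ℓ} := by
    rw [condReported, ProbabilityTheory.cond, ProbabilityTheory.cond, measure_congr hset,
      Measure.restrict_congr_set hset]
  have hint0 : ∀ ψ : ℝ → ℝ, (∀ r, 0 ≤ r → 0 ≤ ψ r) → ∀ E : Set ℝ,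
      0 ≤ ∫ w in E, ψ (μ (t + s - max w 0) - μ (t - max w 0)) ∂(reportMeasure Λ F_D) :=
    fun ψ hψ E => integral_nonneg fun w => hψ _ (hinc _)
  have H₁ := fun x hx z hz => hmodel.lintegral_prod_clusterIncrement (t := t) (x := x) (z := z) hμ
    hp0 hp1 hs.le hc₁ hn₁ hs₁ hx hz
  have H₂ := fun x hx z hz => hmodel.lintegral_prod_clusterIncrement (t := t) (x := x) (z := z) hμ
    hp0 hp1 hs.le hc₂ hn₂ hs₂ hx hz
  simp only [pow_one] at H₁
  have hmean : meanReported T D t P = (reportMeasure Λ F_D).real (Iic t) := by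
    rw [← integral_markedCount hN hA hφ measureReal_nonneg (hint0 ψ₁ hn₁ _) (hint0 ψ₁ hn₁ _) H₁]
    refine integral_congr_ae ?_
    filter_upwards [hcount] with ω hω
    rw [hω]
  have hmain := cond_markedCount_moments hN hA hφ measureReal_nonneg (hint0 ψ₁ hn₁ _)
    (hint0 ψ₁ hn₁ _) (hint0 ψ₂ hn₂ _) (hint0 ψ₂ hn₂ _) H₁ H₂ (l := ℓ)
    (by rwa [← measure_congr hset]) (hmodel.delayedIncrement_ae_eq (t := t) hp0 hp1 hs.le)
  rw [← hcondeq, ← hmean, hmodel.setIntegral_Ioi_eq hμ ht0 hc₁ (by simp [hψ₁]),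
    hmodel.setIntegral_Ioi_eq hμ ht0 hc₂ (by simp [hψ₂]),
    hmodel.setIntegral_Iic_eq (fun w => ψ₁ (μ (t + s - w) - μ (t - w))),
    hmodel.setIntegral_Iic_eq (fun w => ψ₂ (μ (t + s - w) - μ (t - w)))] at hmain
  obtain ⟨hmem, hE, hV⟩ := hmain
  have hI : ∀ g : ℝ → ℝ, Continuous g → IntegrableOn g (Icc 0 t) (reportMeasure Λ F_D) :=
    fun g hg => hg.continuousOn.integrableOn_compact isCompact_Icc
  have e₁ : ∫ w in Icc 0 t, ψ₁ (μ (t + s - w) - μ (t - w)) ∂(reportMeasure Λ F_D)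
      = (1 - p) / p * ∫ w in Icc 0 t, (μ (t + s - w) - μ (t - w)) ∂(reportMeasure Λ F_D) := by
    simp only [hψ₁]
    rw [integral_mul_const, mul_comm]
  have e₂ : ∫ w in Icc 0 t, ψ₂ (μ (t + s - w) - μ (t - w)) ∂(reportMeasure Λ F_D)
      = (1 - p) / p ^ 2 * ∫ w in Icc 0 t, (μ (t + s - w) - μ (t - w)) ∂(reportMeasure Λ F_D)
        + (1 - p) ^ 2 / p ^ 2
          * ∫ w in Icc 0 t, (μ (t + s - w) - μ (t - w)) ^ 2 ∂(reportMeasure Λ F_D) := by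
    simp only [hψ₂]
    rw [integral_add (hI _ (by fun_prop)) (hI _ (by fun_prop)), integral_mul_const,
      integral_mul_const, mul_comm, mul_comm (∫ w in Icc 0 t, (_ : ℝ) ^ 2 ∂_)]
  have hJ : ∀ g : ℝ → ℝ, Continuous g → ∀ v : ℝ,
      IntegrableOn (fun r => g (t + s - v - r)) (Ioc (t - v) (t + s - v)) F_D := fun g hg v =>
    ((by fun_prop : Continuous fun r => g (t + s - v - r)).continuousOn.integrableOn_compact
      isCompact_Icc).mono_set Ioc_subset_Icc_self
  have hJ' : ∀ g : ℝ → ℝ, Continuous g → IntegrableOn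
      (fun v => ∫ r in Ioc (t - v) (t + s - v), g (t + s - v - r) ∂F_D) (Icc 0 1) Λ := by
    intro g hg
    obtain ⟨K, hK⟩ := (isCompact_Icc (a := (0 : ℝ)) (b := s)).exists_bound_of_continuousOn
      hg.continuousOn
    have hK0 : 0 ≤ K := (norm_nonneg _).trans (hK 0 ⟨le_rfl, hs.le⟩)
    have hmeas : StronglyMeasurable fun v : ℝ =>
        ∫ r in Ioc (t - v) (t + s - v), g (t + s - v - r) ∂F_D := by
      -- The domain of the inner integral moves with `v`, so measurability in `v` is read off from
      -- the indicator of a strip in the plane.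
      have hset : MeasurableSet {z : ℝ × ℝ | t - z.1 < z.2 ∧ z.2 ≤ t + s - z.1} :=
        (measurableSet_lt (measurable_fst.const_sub t) measurable_snd).inter
          (measurableSet_le measurable_snd (measurable_fst.const_sub (t + s)))
      have hg2 : StronglyMeasurable fun z : ℝ × ℝ => g (t + s - z.1 - z.2) :=
        (by fun_prop : Continuous fun z : ℝ × ℝ => g (t + s - z.1 - z.2)).stronglyMeasurable
      have := (hg2.indicator hset).integral_prod_right' (ν := F_D)
      refine (funext fun v => ?_ : (fun v : ℝ => _) = _) ▸ this
      rw [← integral_indicator measurableSet_Ioc]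
      rfl
    refine Integrable.of_bound hmeas.aestronglyMeasurable K (Eventually.of_forall fun v => ?_)
    refine (norm_setIntegral_le_of_norm_le_const (measure_lt_top _ _) fun r hr =>
      hK _ ⟨by linarith [hr.2], by linarith [hr.1]⟩).trans ?_
    exact mul_le_of_le_one_right hK0 measureReal_le_one
  have j₁ : ∫ v in Icc (0 : ℝ) 1, (∫ r in Ioc (t - v) (t + s - v), ψ₁ (μ (t + s - v - r)) ∂F_D) ∂Λ
      = (1 - p) / p * ∫ v in Icc (0 : ℝ) 1,
          (∫ r in Ioc (t - v) (t + s - v), μ (t + s - v - r) ∂F_D) ∂Λ := by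
    simp only [hψ₁]
    simp_rw [integral_mul_const]
    rw [mul_comm]
  have j₂ : ∫ v in Icc (0 : ℝ) 1, (∫ r in Ioc (t - v) (t + s - v), ψ₂ (μ (t + s - v - r)) ∂F_D) ∂Λ
      = (1 - p) / p ^ 2 * ∫ v in Icc (0 : ℝ) 1,
          (∫ r in Ioc (t - v) (t + s - v), μ (t + s - v - r) ∂F_D) ∂Λ
        + (1 - p) ^ 2 / p ^ 2 * ∫ v in Icc (0 : ℝ) 1,
          (∫ r in Ioc (t - v) (t + s - v), μ (t + s - v - r) ^ 2 ∂F_D) ∂Λ := by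
    have hadd : ∀ v, ∫ r in Ioc (t - v) (t + s - v), ψ₂ (μ (t + s - v - r)) ∂F_D
        = (1 - p) / p ^ 2 * (∫ r in Ioc (t - v) (t + s - v), μ (t + s - v - r) ∂F_D)
          + (1 - p) ^ 2 / p ^ 2
            * ∫ r in Ioc (t - v) (t + s - v), μ (t + s - v - r) ^ 2 ∂F_D := fun v => by
      simp only [hψ₂]
      rw [integral_add ((hJ μ hμc v).mul_const _) ((hJ (fun y => μ y ^ 2) (by fun_prop) v).mul_const _),
        integral_mul_const, integral_mul_const, mul_comm,
        mul_comm (∫ r in Ioc (t - v) (t + s - v), (_ : ℝ) ^ 2 ∂F_D)]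
    simp_rw [hadd]
    rw [integral_add ((hJ' μ hμc).const_mul _) ((hJ' (fun y => μ y ^ 2) (by fun_prop)).const_mul _),
      integral_const_mul, integral_const_mul]
  simp_rw [integral_div]
  rw [e₁, j₁] at hE
  rw [e₁, e₂, j₂] at hV
  refine ⟨hmem, ?_, ?_⟩
  · rw [hE]; ring
  · rw [hV, hE]
    field_simp
    ring
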